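/- All graphs are finite and simple. A multiset $\mathscr P$ of paths of a graph $G$ is a \emph{$k$-rainbow separating path system} ($k$-RSPS), $k\in\{2,3,\dots\}$, if its elements can be coloured with $k$ colours so that for every two distinct edges $e_1,e_2$ of $G$ there are paths $P_1,P_2\in\mathscr P$ of distinct colours with $e_1\in P_1\not\ni e_2$ and $e_2\in P_2\not\ni e_1$; let $c_k(G)$ be the least cardinality of a $k$-RSPS of $G$. Let $c_\infty(G)$ be the least size of a strongly separating path system of $G$, i.e. a set of paths such that for every ordered pair $(e,f)$ of distinct edges some path of the set contains $e$ and avoids $f$. Put $r_k(G)=c_k(G)/c_\infty(G)$ and, for an infinite class $\Sigma$ of graphs, $r_k(\Sigma)=\limsup_{G\in\Sigma}r_k(G)$. The class $\Sigma$ is \emph{rainbow separable} if for every $\varepsilon>0$ there is $k\in\{2,3,\dots\}$ with $r_k(\Sigma)<1+\varepsilon$, and its \emph{chromatic separation number} is $\chi_{rs}(\Sigma)=\min\{k\in\{2,3,\dots\}\cup\{\infty\} : r_k(\Sigma)=1\}$. A \emph{complete binary tree} is a rooted tree in which every vertex has either no child or exactly two children, and all leaves have the same distance from the root. Let $\mathcal{BT}$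 be the class of complete binary trees. \textbf{Theorem.} The class $\mathcal{BT}$ is rainbow separable, but $\chi_{rs}(\mathcal{BT})=\infty$. More precisely, for every $k\in\{2,3,\dots\}$ there is $n_0=n_0(k)$ such that for every complete binary tree $T$ on $n\ge n_0$ vertices (i) every $k$-RSPS of $T$ has at least $\left(1+16^{-(k+6)}\right)c_\infty(T)$ paths; (ii) $T$ has a $k$-RSPS with at most $\dfrac{n+1}{k}\cdot\dfrac{k+2\log_2 k+6}{2}$ paths. Moreover, $r_k(\mathcal{BT})\to 1$ as $k\to\infty$. -/

import Mathlib

open Filter Topology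
open scoped ENNReal

noncomputable section

namespace RainbowSep

/-- The paths of a simple graph, as (unoriented) subgraphs. -/
def GraphPath {V : Type*} (G : SimpleGraph V) : Type _ :=
  {H : G.Subgraph // ∃ (u v : V) (p : G.Walk u v), p.IsPath ∧ H = p.toSubgraph}

/-- The edges of a path. -/
def GraphPath.edges {V : Type*} {G : SimpleGraph V} (P : GraphPath G) : Set (Sym2 V) :=
  P.1.edgeSet

/-- A set of paths is strongly separating if for every ordered pair `(e, f)` of distinct edges
some path contains `e` and avoids `f`. -/
def IsStronglySeparating {V : Type*} {G : SimpleGraph V} (S : Finset (GraphPath G)) : Prop :=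
  ∀ e ∈ G.edgeSet, ∀ f ∈ G.edgeSet, e ≠ f → ∃ P ∈ S, e ∈ P.edges ∧ f ∉ P.edges

/-- The strong separation number. -/
def ssp {V : Type*} (G : SimpleGraph V) : ℕ :=
  sInf {m | ∃ S : Finset (GraphPath G), IsStronglySeparating S ∧ S.card = m}

/-- A multiset `S` of paths is a `k`-rainbow separating path system if its elements can be coloured
with `k` colours (the coloured multiset is `C`) so that any two distinct edges are separated from
each other by two paths of distinct colours. -/
def IsRSPS {V : Type*} {G : SimpleGraph V} (k : ℕ) (S : Multiset (GraphPath G)) : Prop :=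
  ∃ C : Multiset (GraphPath G × Fin k), C.map Prod.fst = S ∧
    ∀ e ∈ G.edgeSet, ∀ f ∈ G.edgeSet, e ≠ f →
      ∃ P ∈ C, ∃ Q ∈ C, P.2 ≠ Q.2 ∧
        (e ∈ P.1.edges ∧ f ∉ P.1.edges) ∧ (f ∈ Q.1.edges ∧ e ∉ Q.1.edges)

/-- The `k`-rainbow separation number `c_k(G)` for `k ∈ {2, 3, …} ∪ {∞}`, where
`c_∞(G) = ssp(G)`. For finite `G` and these `k` the infimum is over a nonempty set. -/
def rainbowSepNumber {V : Type*} (G : SimpleGraph V) (k : ℕ∞) : ℕ :=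
  if k = ⊤ then ssp G
  else sInf {m | ∃ S : Multiset (GraphPath G), IsRSPS k.toNat S ∧ S.card = m}

/-- The `k`-rainbow separation ratio `r_k(G) = c_k(G) / c_∞(G)`. -/
def ratio {V : Type*} (G : SimpleGraph V) (k : ℕ∞) : ℝ≥0∞ :=
  (rainbowSepNumber G k : ℝ≥0∞) / (rainbowSepNumber G ⊤ : ℝ≥0∞)

/-- Finite graphs, with vertex set `{0, …, n - 1}`. There are finitely many of each order. -/
abbrev FinGraph : Type := Σ n : ℕ, SimpleGraph (Fin n)

/-- The `k`-rainbow separation ratio of a class of graphs: the upper limit of `r_k(G)` over the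
members `G` of the class (finitely many members being negligible). -/
def classRatio (A : Set FinGraph) (k : ℕ∞) : ℝ≥0∞ :=
  limsup (fun G : FinGraph => ratio G.2 k) (cofinite ⊓ 𝓟 A)

/-- A class of graphs is rainbow separable if its ratios come arbitrarily close to `1`. -/
def IsRainbowSeparable (A : Set FinGraph) : Prop :=
  ∀ ε : ℝ, 0 < ε → ∃ k : ℕ, 2 ≤ k ∧ classRatio A (k : ℕ∞) < 1 + ENNReal.ofReal ε

/-- The chromatic separation number of a class of graphs. -/
def chromaticSepNumber (A : Set FinGraph) : ℕ∞ :=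
  sInf {k : ℕ∞ | 2 ≤ k ∧ classRatio A k = 1}

/-- Degree of a vertex. -/
def deg {V : Type*} (G : SimpleGraph V) (v : V) : ℕ := (G.neighborSet v).ncard

/-- A complete binary tree: a tree with a root that has two children (or none, for the tree with
one vertex), such that every vertex other than the root is a leaf or has degree `3`, and all leaves
have the same distance from the root. -/
def IsCompleteBinaryTree {V : Type*} (G : SimpleGraph V) : Prop :=
  G.IsTree ∧ ∃ root : V, (deg G root = 0 ∨ deg G root = 2) ∧
    (∀ v, v ≠ root → deg G v = 1 ∨ deg G v = 3) ∧
    ∃ d : ℕ, ∀ v, deg G v = 1 → G.dist root v = d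

/-- The class of complete binary trees. -/
def completeBinaryTrees : Set FinGraph := {G | IsCompleteBinaryTree G.2}

end RainbowSep

end

open RainbowSep

/-!
Number the vertices of a complete binary tree of depth `d` from `1` in breadth-first order, so that
`m` has the children `2 * m` and `2 * m + 1`.

For the lower bounds, count the ends of paths. The path sets of the three edges at an inner vertex
form an antichain, and a path which is on exactly one of these edges ends at the vertex. Every path
through a leaf edge ends at the leaf, so the parent of two leaves and these leaves account for at
least four ends. Hence a subtree of height `j` with all its leaves at depth `d` has at least
`2 ^ (j + 1)` ends, with equality only if every edge of the subtree is on exactly two paths and no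
path ends at an inner vertex. With `k` colours equality is impossible for `j = k`: a path through
the edge above the subtree would run down to a leaf, and the second paths through its `k + 1` edges
would need pairwise distinct colours. So each of these subtrees has an additional end.

For the upper bounds, cut the tree into single edges near the root and, below them, subtrees of
height `h` with the edge above their roots. Drawn in the plane, such a block has `2 ^ h + 1`
terminals, and the paths joining cyclically consecutive terminals cover each of its edges exactly
twice, no two edges being on the same two paths. Hence `2 ^ h + 1` colours, one for each of these
paths, suffice. About `2 ^ d * (1 + 3 / 2 ^ h)` paths are used, while `c_∞` lies between `2 ^ d` and
`2 ^ d + 2`.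
-/

open scoped Finset

noncomputable section

namespace RainbowSep

section Families

variable {V ι κ : Type*} {G : SimpleGraph V}

open scoped Classical in
/-- The set consisting of the two end vertices of a path (which coincide for a trivial path). -/
def GraphPath.ends (P : GraphPath G) : Finset V :=
  {P.2.choose, P.2.choose_spec.choose}

theorem GraphPath.card_ends_le_two (P : GraphPath G) : #P.ends ≤ 2 := by
  classical exact Finset.card_le_two

theorem GraphPath.exists_ne_mem_edges {P : GraphPath G} {e : Sym2 V} {x : V} (he : e ∈ P.edges)
    (hxe : x ∈ e) (hx : x ∉ P.ends) : ∃ e' ∈ P.edges, e' ≠ e ∧ x ∈ e' := by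
  classical
  obtain ⟨p, hp, hPp⟩ := P.2.choose_spec.choose_spec
  have edges_eq (e' : Sym2 V) : e' ∈ P.edges ↔ e' ∈ p.edges := by
    rw [← p.mem_edges_toSubgraph, ← hPp]
    rfl
  simp only [GraphPath.ends, Finset.mem_insert, Finset.mem_singleton, not_or] at hx
  have heven : Even (p.edges.countP (x ∈ ·)) := (hp.isTrail.even_countP_edges_iff x).2 fun _ => hx
  by_contra! honly
  have hone : p.edges.countP (x ∈ ·) = p.edges.count e :=
    List.countP_congr fun e' he' => by
      simp only [decide_eq_true_eq, beq_iff_eq]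
      exact ⟨fun hxe' => by_contra fun hne => honly e' ((edges_eq e').2 he') hne hxe',
        fun h => h ▸ hxe⟩
  rw [hone, List.count_eq_one_of_mem hp.isTrail.edges_nodup ((edges_eq e).1 he)] at heven
  exact absurd heven (by decide)

theorem GraphPath.edges_subset (P : GraphPath G) : P.edges ⊆ G.edgeSet :=
  P.1.edgeSet_subset

/-- The version of `IsStronglySeparating` for indexed families of paths. -/
def Separates (P : ι → GraphPath G) : Prop :=
  ∀ e ∈ G.edgeSet, ∀ f ∈ G.edgeSet, e ≠ f → ∃ i, e ∈ (P i).edges ∧ f ∉ (P i).edges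

/-- The version of `IsRSPS` for indexed families of paths, with an explicit colouring `c`. -/
def RainbowSeparates (P : ι → GraphPath G) (c : ι → κ) : Prop :=
  ∀ e ∈ G.edgeSet, ∀ f ∈ G.edgeSet, e ≠ f → ∃ i j, c i ≠ c j ∧
    (e ∈ (P i).edges ∧ f ∉ (P i).edges) ∧ (f ∈ (P j).edges ∧ e ∉ (P j).edges)

theorem RainbowSeparates.separates {P : ι → GraphPath G} {c : ι → κ} (h : RainbowSeparates P c) :
    Separates P := fun e he f hf hef =>
  let ⟨i, _, _, hi, _⟩ := h e he f hf hef
  ⟨i, hi⟩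

theorem IsStronglySeparating.separates {S : Finset (GraphPath G)} (h : IsStronglySeparating S) :
    Separates (fun P : S => P.1) := fun e he f hf hef =>
  let ⟨P, hPS, hP⟩ := h e he f hf hef
  ⟨⟨P, hPS⟩, hP⟩

theorem IsRSPS.exists_rainbowSeparates {k : ℕ} {S : Multiset (GraphPath G)} (h : IsRSPS k S) :
    ∃ (P : Fin S.card → GraphPath G) (c : Fin S.card → Fin k), RainbowSeparates P c := by
  obtain ⟨C, rfl, hC⟩ := h
  rw [Multiset.card_map, ← Multiset.length_toList]
  refine ⟨fun i => (C.toList.get i).1, fun i => (C.toList.get i).2, fun e he f hf hef => ?_⟩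
  obtain ⟨P, hP, Q, hQ, hsep⟩ := hC e he f hf hef
  obtain ⟨i, rfl⟩ := List.get_of_mem (Multiset.mem_toList.2 hP)
  obtain ⟨j, rfl⟩ := List.get_of_mem (Multiset.mem_toList.2 hQ)
  exact ⟨i, j, hsep⟩

theorem RainbowSeparates.isRSPS [Fintype ι] {k : ℕ} {P : ι → GraphPath G} {c : ι → Fin k}
    (h : RainbowSeparates P c) : IsRSPS k (Finset.univ.val.map P) := by
  refine ⟨Finset.univ.val.map fun i => (P i, c i), by rw [Multiset.map_map]; rfl,
    fun e he f hf hef => ?_⟩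
  obtain ⟨i, j, hsep⟩ := h e he f hf hef
  exact ⟨_, Multiset.mem_map_of_mem _ (Finset.mem_univ_val i),
    _, Multiset.mem_map_of_mem _ (Finset.mem_univ_val j), hsep⟩

theorem IsRSPS.exists_isStronglySeparating {k : ℕ} {S : Multiset (GraphPath G)} (h : IsRSPS k S) :
    ∃ S' : Finset (GraphPath G), IsStronglySeparating S' ∧ #S' ≤ S.card := by
  classical
  obtain ⟨C, rfl, hC⟩ := h
  refine ⟨(C.map Prod.fst).toFinset, fun e he f hf hef => ?_, Multiset.toFinset_card_le _⟩
  obtain ⟨P, hP, -, -, -, hsep, -⟩ := hC e he f hf hef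
  exact ⟨P.1, Multiset.mem_toFinset.2 (Multiset.mem_map_of_mem _ hP), hsep⟩

theorem four_le_card_add_card_add_card_of_antichain [DecidableEq ι] {A B C D : Finset ι}
    (hAB : ¬ A ⊆ B) (hAC : ¬ A ⊆ C) (hBA : ¬ B ⊆ A) (hBC : ¬ B ⊆ C) (hCA : ¬ C ⊆ A)
    (hCB : ¬ C ⊆ B) (hA : A \ (B ∪ C) ⊆ D) (hB : B \ (A ∪ C) ⊆ D) (hC : C \ (A ∪ B) ⊆ D) :
    4 ≤ #B + #C + #D ∧ (#B + #C + #D = 4 → #A = 2 ∧ #B = 2 ∧ #C = 2 ∧ #D = 0) := by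
  have card_sdiff_eq (X Y Z : Finset ι) : #(X \ Y) = #((X ∩ Z) \ Y) + #(X \ (Y ∪ Z)) := by
    rw [← Finset.card_inter_add_card_sdiff (X \ Y) Z, Finset.sdiff_inter_right_comm,
      sdiff_sdiff_left]
    rfl
  have card_eq (X Y Z : Finset ι) : #X = #(X ∩ Y ∩ Z) + #((X ∩ Y) \ Z) + #(X \ Y) := by
    rw [Finset.card_inter_add_card_sdiff, Finset.card_inter_add_card_sdiff]
  have one_le {X Y : Finset ι} (h : ¬ X ⊆ Y) : 1 ≤ #(X \ Y) :=
    (Finset.sdiff_nonempty.2 h).card_pos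
  have hexact : #(A \ (B ∪ C)) + #(B \ (A ∪ C)) + #(C \ (A ∪ B)) ≤ #D := by
    rw [← Finset.card_union_of_disjoint, ← Finset.card_union_of_disjoint]
    · exact Finset.card_le_card (Finset.union_subset (Finset.union_subset hA hB) hC)
    all_goals
      simp only [Finset.disjoint_left, Finset.mem_union, Finset.mem_sdiff]
      tauto
  have hA' := card_eq A B C
  have hB' := card_eq B A C
  have hC' := card_eq C A B
  have := one_le hAB; have := one_le hAC; have := one_le hBA
  have := one_le hBC; have := one_le hCA; have := one_le hCB
  have := card_sdiff_eq A B C; have := card_sdiff_eq A C B; have := card_sdiff_eq B A C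
  have := card_sdiff_eq B C A; have := card_sdiff_eq C A B; have := card_sdiff_eq C B A
  simp only [Finset.inter_comm B A, Finset.inter_comm C A, Finset.inter_comm C B,
    Finset.inter_right_comm A C B, Finset.union_comm C B, Finset.union_comm C A,
    Finset.union_comm B A] at *
  omega

variable [Fintype ι]

open scoped Classical in
/-- The indices of the paths of a family that contain the edge `e`. -/
def through (P : ι → GraphPath G) (e : Sym2 V) : Finset ι := {i | e ∈ (P i).edges}

open scoped Classical in
/-- The indices of the paths of a family that end at the vertex `v`. -/
def endsAt (P : ι → GraphPath G) (v : V) : Finset ι := {i | v ∈ (P i).ends}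

theorem mem_through {P : ι → GraphPath G} {e : Sym2 V} {i : ι} :
    i ∈ through P e ↔ e ∈ (P i).edges := by
  simp only [through, Finset.mem_filter_univ]

theorem mem_endsAt {P : ι → GraphPath G} {v : V} {i : ι} :
    i ∈ endsAt P v ↔ v ∈ (P i).ends := by
  simp only [endsAt, Finset.mem_filter_univ]

theorem sum_card_endsAt_le (P : ι → GraphPath G) (s : Finset V) :
    ∑ v ∈ s, #(endsAt P v) ≤ 2 * Fintype.card ι := by
  classical
  calc ∑ v ∈ s, #(endsAt P v)
      = ∑ i, #{v ∈ s | v ∈ (P i).ends} :=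
        Finset.sum_card_bipartiteAbove_eq_sum_card_bipartiteBelow _
    _ ≤ ∑ _i : ι, 2 := Finset.sum_le_sum fun i _ =>
        (Finset.card_le_card fun v hv => (Finset.mem_filter.1 hv).2).trans (P i).card_ends_le_two
    _ = 2 * Fintype.card ι := by rw [Finset.sum_const, smul_eq_mul, mul_comm, Finset.card_univ]

theorem Separates.not_through_subset {P : ι → GraphPath G} (hP : Separates P) {e f : Sym2 V}
    (he : e ∈ G.edgeSet) (hf : f ∈ G.edgeSet) (hef : e ≠ f) : ¬ through P e ⊆ through P f := by
  obtain ⟨i, hie, hif⟩ := hP e he f hf hef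
  exact fun h => hif (mem_through.1 (h (mem_through.2 hie)))

theorem exists_ne_mem_through {P : ι → GraphPath G} {e : Sym2 V} {x : V} {i : ι}
    (hi : i ∈ through P e) (hxe : x ∈ e) (hx : i ∉ endsAt P x) :
    ∃ f ∈ G.incidenceSet x, f ≠ e ∧ i ∈ through P f := by
  obtain ⟨f, hf, hfe, hxf⟩ :=
    GraphPath.exists_ne_mem_edges (mem_through.1 hi) hxe (mt mem_endsAt.2 hx)
  exact ⟨f, ⟨(P i).edges_subset hf, hxf⟩, hfe, mem_through.2 hf⟩

theorem through_subset_endsAt {P : ι → GraphPath G} {x : V} {e : Sym2 V}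
    (hx : G.incidenceSet x = {e}) : through P e ⊆ endsAt P x := by
  intro i hi
  have hxe : x ∈ e := (hx ▸ Set.mem_singleton e : e ∈ G.incidenceSet x).2
  by_contra hend
  obtain ⟨f, hf, hfe, -⟩ := exists_ne_mem_through hi hxe hend
  rw [hx] at hf
  exact hfe hf

theorem through_sdiff_subset_endsAt [DecidableEq ι] {P : ι → GraphPath G} {x : V}
    {e f g : Sym2 V} (hx : G.incidenceSet x = {e, f, g}) :
    through P e \ (through P f ∪ through P g) ⊆ endsAt P x := by
  intro i hi
  simp only [Finset.mem_sdiff, Finset.mem_union, not_or] at hi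
  have hxe : x ∈ e := (hx ▸ Set.mem_insert e _ : e ∈ G.incidenceSet x).2
  by_contra hend
  obtain ⟨e', he', hne, hie'⟩ := exists_ne_mem_through hi.1 hxe hend
  rw [hx] at he'
  rcases he' with rfl | rfl | rfl
  exacts [hne rfl, hi.2.1 hie', hi.2.2 hie']

theorem Separates.four_le_card_through_add_card_through_add_card_endsAt {P : ι → GraphPath G}
    (hP : Separates P) {x : V} {e f g : Sym2 V} (hx : G.incidenceSet x = {e, f, g})
    (hef : e ≠ f) (heg : e ≠ g) (hfg : f ≠ g) :
    4 ≤ #(through P f) + #(through P g) + #(endsAt P x) ∧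
      (#(through P f) + #(through P g) + #(endsAt P x) = 4 →
        #(through P e) = 2 ∧ #(through P f) = 2 ∧ #(through P g) = 2 ∧ #(endsAt P x) = 0) := by
  classical
  have hsub : {e, f, g} ⊆ G.edgeSet := hx ▸ G.incidenceSet_subset x
  have he : e ∈ G.edgeSet := hsub (by simp)
  have hf : f ∈ G.edgeSet := hsub (by simp)
  have hg : g ∈ G.edgeSet := hsub (by simp)
  exact four_le_card_add_card_add_card_of_antichain
    (hP.not_through_subset he hf hef) (hP.not_through_subset he hg heg)
    (hP.not_through_subset hf he hef.symm) (hP.not_through_subset hf hg hfg)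
    (hP.not_through_subset hg he heg.symm) (hP.not_through_subset hg hf hfg.symm)
    (through_sdiff_subset_endsAt hx)
    (through_sdiff_subset_endsAt (by rw [hx, Set.insert_comm]))
    (through_sdiff_subset_endsAt (by rw [hx, Set.pair_comm f g, Set.insert_comm]))

/-- Two such edges can only be separated from each other by the second paths through them, which
therefore have distinct colours. -/
theorem RainbowSeparates.card_le_of_card_through_eq_two [Fintype κ] {P : ι → GraphPath G}
    {c : ι → κ} (hP : RainbowSeparates P c) {i : ι} {s : Finset (Sym2 V)}
    (hi : ∀ e ∈ s, i ∈ through P e) (hs : ∀ e ∈ s, #(through P e) = 2) :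
    #s ≤ Fintype.card κ := by
  classical
  have exists_other : ∀ e ∈ s, ∃ j, (through P e).erase i = {j} := fun e he =>
    Finset.card_eq_one.1 (by rw [Finset.card_erase_of_mem (hi e he), hs e he])
  have : Nonempty ι := ⟨i⟩
  choose! other hother using exists_other
  have eq_other {e f : Sym2 V} (he : e ∈ s) (hf : f ∈ s) {j : ι} (hje : e ∈ (P j).edges)
      (hjf : f ∉ (P j).edges) : j = other e := by
    rw [← Finset.mem_singleton, ← hother e he, Finset.mem_erase, mem_through]
    exact ⟨fun h => hjf (h ▸ mem_through.1 (hi f hf)), hje⟩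
  have hinj : Set.InjOn (fun e => c (other e)) s := by
    intro e he f hf hcol
    by_contra hne
    have hedge {e : Sym2 V} (he : e ∈ s) := (P i).edges_subset (mem_through.1 (hi e he))
    obtain ⟨j, j', hjj', ⟨hje, hjf⟩, hjf', hje'⟩ := hP e (hedge he) f (hedge hf) hne
    rw [eq_other he hf hje hjf, eq_other hf he hjf' hje'] at hjj'
    exact hjj' hcol
  simpa using Finset.card_le_card_of_injOn _ (fun e _ => Finset.mem_univ (c (other e))) hinj

theorem rainbowSeparates_of_card_through_eq_two {β : Type*} {P : ι → GraphPath G} {c : ι → κ}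
    {b : ι → β} (htwo : ∀ e ∈ G.edgeSet, #(through P e) = 2)
    (hblock : ∀ e ∈ G.edgeSet, ∀ i ∈ through P e, ∀ j ∈ through P e, b i = b j)
    (hinj : Set.InjOn (through P) G.edgeSet) (hc : ∀ i j, b i = b j → c i = c j → i = j) :
    RainbowSeparates P c := by
  classical
  intro e he f hf hef
  simp only [← mem_through]
  have hthrough : through P e ≠ through P f := hinj.ne he hf hef
  have hcard : #(through P e) = #(through P f) := (htwo e he).trans (htwo f hf).symm
  obtain ⟨i, hie, hif⟩ := Finset.not_subset.1 fun h =>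
    hthrough (Finset.eq_of_subset_of_card_le h hcard.ge)
  obtain ⟨j, hjf, hje⟩ := Finset.not_subset.1 fun h =>
    hthrough (Finset.eq_of_subset_of_card_le h hcard.le).symm
  by_cases hcij : c i = c j
  · obtain ⟨i', hie', hii'⟩ := Finset.exists_mem_ne (by rw [htwo e he]; norm_num) i
    have hci : c i' ≠ c i := fun h => hii' (hc _ _ (hblock e he _ hie' _ hie) h)
    refine ⟨i', j, hcij ▸ hci, ⟨hie', fun hif' => hif ?_⟩, hjf, hje⟩
    have : i = j := hc _ _ ((hblock e he _ hie _ hie').trans (hblock f hf _ hif' _ hjf)) hcij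
    exact this ▸ hjf
  · exact ⟨i, j, hcij, ⟨hie, hif⟩, hjf, hje⟩

end Families

section HeapOrder

/-- `x` is `w` or one of its descendants in the infinite binary tree on the positive integers in
which the children of `m` are `2 * m` and `2 * m + 1`. -/
def HeapDesc (w x : ℕ) : Prop := ∃ j, x / 2 ^ j = w

theorem HeapDesc.refl (w : ℕ) : HeapDesc w w := ⟨0, by simp⟩

theorem HeapDesc.le {w x : ℕ} (h : HeapDesc w x) : w ≤ x := by
  obtain ⟨j, rfl⟩ := h
  exact Nat.div_le_self _ _

theorem heapDesc_iff_eq_or_half {w x : ℕ} : HeapDesc w x ↔ x = w ∨ HeapDesc w (x / 2) := by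
  constructor
  · rintro ⟨_ | j, rfl⟩
    · exact Or.inl (by simp)
    · exact Or.inr ⟨j, by rw [Nat.div_div_eq_div_mul, ← pow_succ']⟩
  · rintro (rfl | ⟨j, rfl⟩)
    · exact .refl x
    · exact ⟨j + 1, by rw [pow_succ', ← Nat.div_div_eq_div_mul]⟩

theorem heapDesc_iff_half_of_ne {w x : ℕ} (h : x ≠ w) : HeapDesc w x ↔ HeapDesc w (x / 2) := by
  rw [heapDesc_iff_eq_or_half, or_iff_right h]

theorem not_heapDesc_half {w : ℕ} (h : 1 ≤ w) : ¬ HeapDesc w (w / 2) := fun h' => by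
  have := h'.le
  omega

end HeapOrder

section Cut

variable {V : Type*} {G : SimpleGraph V}

theorem odd_count_edges_iff_of_cut [DecidableEq V] {e : Sym2 V} {D : V → Prop}
    (he : ∀ u v, G.Adj u v → (s(u, v) = e ↔ ¬ (D u ↔ D v))) {u v : V} (p : G.Walk u v) :
    Odd (p.edges.count e) ↔ ¬ (D u ↔ D v) := by
  induction p with
  | nil => simp
  | @cons u v w h p ih =>
    have := he u v h
    rw [SimpleGraph.Walk.edges_cons, List.count_cons]
    by_cases huv : s(u, v) = e
    · simp only [huv, beq_self_eq_true, if_true, Nat.odd_add_one, ih]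
      tauto
    · simp only [beq_iff_eq, huv, if_false, add_zero, ih]
      tauto

theorem mem_edges_iff_of_cut {e : Sym2 V} {D : V → Prop}
    (he : ∀ u v, G.Adj u v → (s(u, v) = e ↔ ¬ (D u ↔ D v))) {u v : V} {p : G.Walk u v}
    (hp : p.IsTrail) : e ∈ p.edges ↔ ¬ (D u ↔ D v) := by
  classical
  rw [← odd_count_edges_iff_of_cut he p]
  refine ⟨fun h => ?_, fun h => List.count_pos_iff.1 h.pos⟩
  rw [List.count_eq_one_of_mem hp.edges_nodup h]
  exact odd_one

theorem deg_eq_ncard_incidenceSet (v : V) : deg G v = (G.incidenceSet v).ncard := by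
  classical
  rw [deg, ← Nat.card_coe_set_eq, ← Nat.card_coe_set_eq]
  exact Nat.card_congr (G.incidenceSetEquivNeighborSet v).symm

end Cut

/-- A labelling of the vertices of `G` by `1, …, 2 ^ (d + 1) - 1` under which the neighbours of a
vertex are its half (rounded down) and its doubles `2 * x`, `2 * x + 1`. The values of `vert`
outside this range are irrelevant. -/
structure HeapLabelling {V : Type*} (G : SimpleGraph V) (d : ℕ) where
  label : V → ℕ
  vert : ℕ → V
  label_pos : ∀ v, 1 ≤ label v
  label_lt : ∀ v, label v < 2 ^ (d + 1)
  vert_label : ∀ v, vert (label v) = v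
  label_vert : ∀ m, 1 ≤ m → m < 2 ^ (d + 1) → label (vert m) = m
  adj_iff : ∀ u v, G.Adj u v ↔ label u = label v / 2 ∨ label v = label u / 2

namespace HeapLabelling

variable {V : Type*} {G : SimpleGraph V} {d : ℕ} (H : HeapLabelling G d)

include H in
theorem card_eq [Fintype V] : Fintype.card V = 2 ^ (d + 1) - 1 := by
  rw [← Nat.card_Ico, ← Finset.card_univ]
  exact Finset.card_nbij' H.label H.vert
    (fun v _ => Finset.mem_Ico.2 ⟨H.label_pos v, H.label_lt v⟩) (fun _ _ => Finset.mem_univ _)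
    (fun v _ => H.vert_label v)
    (fun m hm => H.label_vert m (Finset.mem_Ico.1 hm).1 (Finset.mem_Ico.1 hm).2)

/-- The edge from the vertex labelled `w` to its parent. The edges of `G` correspond to the labels
from `2` on. -/
def edge (w : ℕ) : Sym2 V := s(H.vert w, H.vert (w / 2))

theorem vert_eq_vert_iff {m n : ℕ} (hm : 1 ≤ m) (hm' : m < 2 ^ (d + 1)) (hn : 1 ≤ n)
    (hn' : n < 2 ^ (d + 1)) : H.vert m = H.vert n ↔ m = n := by
  refine ⟨fun h => ?_, congrArg _⟩
  rw [← H.label_vert m hm hm', h, H.label_vert n hn hn']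

theorem vert_mem_edge_iff {m w : ℕ} (hm : 1 ≤ m) (hm' : m < 2 ^ (d + 1)) (hw : 2 ≤ w)
    (hw' : w < 2 ^ (d + 1)) : H.vert m ∈ H.edge w ↔ w = m ∨ w / 2 = m := by
  rw [edge, Sym2.mem_iff, H.vert_eq_vert_iff hm hm' (by omega) hw',
    H.vert_eq_vert_iff hm hm' (by omega) (by omega), eq_comm, @eq_comm _ m]

theorem edge_mem_edgeSet {w : ℕ} (hw : 2 ≤ w) (hw' : w < 2 ^ (d + 1)) :
    H.edge w ∈ G.edgeSet := by
  rw [edge, SimpleGraph.mem_edgeSet, H.adj_iff, H.label_vert w (by omega) hw',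
    H.label_vert (w / 2) (by omega) (by omega)]
  exact Or.inr rfl

theorem edge_label {u v : V} (h : H.label u = H.label v / 2) : H.edge (H.label v) = s(u, v) := by
  rw [edge, ← h, H.vert_label, H.vert_label, Sym2.eq_swap]

theorem exists_edge_eq {e : Sym2 V} (he : e ∈ G.edgeSet) :
    ∃ w, 2 ≤ w ∧ w < 2 ^ (d + 1) ∧ H.edge w = e := by
  induction e with | _ u v
  have hu := H.label_pos u
  have hv := H.label_pos v
  rcases (H.adj_iff u v).1 he with h | h
  · exact ⟨H.label v, by omega, H.label_lt v, H.edge_label h⟩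
  · exact ⟨H.label u, by omega, H.label_lt u, (H.edge_label h).trans Sym2.eq_swap⟩

theorem edge_injOn : Set.InjOn H.edge (Set.Ico 2 (2 ^ (d + 1))) := by
  rintro w ⟨hw, hw'⟩ x ⟨hx, hx'⟩ h
  have hwx := (H.vert_mem_edge_iff (by omega) hw' hx hx').1 (h ▸ Sym2.mem_mk_left _ _)
  have hxw := (H.vert_mem_edge_iff (by omega) hx' hw hw').1 (h ▸ Sym2.mem_mk_left _ _)
  omega

theorem mem_incidenceSet_vert_iff {m : ℕ} (hm : 1 ≤ m) (hm' : m < 2 ^ (d + 1)) {e : Sym2 V} :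
    e ∈ G.incidenceSet (H.vert m) ↔
      ∃ w, 2 ≤ w ∧ w < 2 ^ (d + 1) ∧ (w = m ∨ w / 2 = m) ∧ e = H.edge w := by
  constructor
  · rintro ⟨he, hme⟩
    obtain ⟨w, hw, hw', rfl⟩ := H.exists_edge_eq he
    exact ⟨w, hw, hw', (H.vert_mem_edge_iff hm hm' hw hw').1 hme, rfl⟩
  · rintro ⟨w, hw, hw', hwm, rfl⟩
    exact ⟨H.edge_mem_edgeSet hw hw', (H.vert_mem_edge_iff hm hm' hw hw').2 hwm⟩

theorem incidenceSet_root (hd : 1 ≤ d) : G.incidenceSet (H.vert 1) = {H.edge 2, H.edge 3} := by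
  have hpow : 2 ^ (1 + 1) ≤ 2 ^ (d + 1) := Nat.pow_le_pow_right two_pos (by omega)
  ext e
  rw [H.mem_incidenceSet_vert_iff le_rfl (by omega), Set.mem_insert_iff, Set.mem_singleton_iff]
  constructor
  · rintro ⟨w, hw, -, hw1, rfl⟩
    obtain rfl | rfl : w = 2 ∨ w = 3 := by omega
    exacts [Or.inl rfl, Or.inr rfl]
  · rintro (rfl | rfl)
    exacts [⟨2, by omega, by omega, by omega, rfl⟩, ⟨3, by omega, by omega, by omega, rfl⟩]

theorem incidenceSet_of_lt_two_pow {m : ℕ} (hm : 2 ≤ m) (hm' : m < 2 ^ d) :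
    G.incidenceSet (H.vert m) = {H.edge m, H.edge (2 * m), H.edge (2 * m + 1)} := by
  ext e
  simp only [H.mem_incidenceSet_vert_iff (show 1 ≤ m by omega) (by omega), Set.mem_insert_iff,
    Set.mem_singleton_iff]
  constructor
  · rintro ⟨w, -, -, hwm, rfl⟩
    obtain rfl | rfl | rfl : w = m ∨ w = 2 * m ∨ w = 2 * m + 1 := by omega
    exacts [Or.inl rfl, Or.inr (Or.inl rfl), Or.inr (Or.inr rfl)]
  · rintro (rfl | rfl | rfl)
    exacts [⟨m, by omega, by omega, by omega, rfl⟩, ⟨2 * m, by omega, by omega, by omega, rfl⟩,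
      ⟨2 * m + 1, by omega, by omega, by omega, rfl⟩]

theorem incidenceSet_of_two_pow_le {m : ℕ} (hm : 2 ≤ m) (hdm : 2 ^ d ≤ m)
    (hm' : m < 2 ^ (d + 1)) : G.incidenceSet (H.vert m) = {H.edge m} := by
  ext e
  rw [H.mem_incidenceSet_vert_iff (by omega) hm', Set.mem_singleton_iff]
  constructor
  · rintro ⟨w, -, hw', hwm, rfl⟩
    rw [show w = m by omega]
  · rintro rfl
    exact ⟨m, hm, hm', Or.inl rfl, rfl⟩

theorem exists_walk_length_eq_log {m : ℕ} (hm : 1 ≤ m) (hm' : m < 2 ^ (d + 1)) :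
    ∃ p : G.Walk (H.vert 1) (H.vert m), p.length = Nat.log 2 m := by
  induction m using Nat.strong_induction_on with | _ m ih
  obtain rfl | hm2 : m = 1 ∨ 2 ≤ m := by omega
  · exact ⟨.nil, by simp⟩
  · obtain ⟨p, hp⟩ := ih (m / 2) (by omega) (by omega) (by omega)
    have hadj : G.Adj (H.vert m) (H.vert (m / 2)) := H.edge_mem_edgeSet hm2 hm'
    refine ⟨p.concat hadj.symm, ?_⟩
    rw [SimpleGraph.Walk.length_concat, hp, Nat.log_of_one_lt_of_le one_lt_two hm2]

include H in
theorem connected : G.Connected := by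
  have : Nonempty V := ⟨H.vert 1⟩
  have reachable_root (v : V) : G.Reachable (H.vert 1) v := by
    obtain ⟨p, -⟩ := H.exists_walk_length_eq_log (H.label_pos v) (H.label_lt v)
    exact ⟨p.copy rfl (H.vert_label v)⟩
  exact ⟨fun u v => (reachable_root u).symm.trans (reachable_root v)⟩

theorem eq_edge_iff_of_adj {w : ℕ} (hw : 2 ≤ w) (hw' : w < 2 ^ (d + 1)) (u v : V)
    (h : G.Adj u v) :
    s(u, v) = H.edge w ↔ ¬ (HeapDesc w (H.label u) ↔ HeapDesc w (H.label v)) := by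
  wlog huv : H.label u = H.label v / 2 generalizing u v
  · rw [Sym2.eq_swap, this v u h.symm (((H.adj_iff u v).1 h).resolve_left huv), not_iff_not]
    exact iff_comm
  have hu := H.label_pos u
  rw [← H.edge_label huv, H.edge_injOn.eq_iff ⟨by omega, H.label_lt v⟩ ⟨hw, hw'⟩, huv]
  by_cases hvw : H.label v = w
  · have := not_heapDesc_half (w := w) (by omega)
    have := HeapDesc.refl w
    rw [hvw]
    tauto
  · rw [heapDesc_iff_half_of_ne hvw]
    tauto

theorem edge_mem_edges_iff {w : ℕ} (hw : 2 ≤ w) (hw' : w < 2 ^ (d + 1)) {u v : V}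
    {p : G.Walk u v} (hp : p.IsTrail) :
    H.edge w ∈ p.edges ↔ ¬ (HeapDesc w (H.label u) ↔ HeapDesc w (H.label v)) :=
  mem_edges_iff_of_cut (D := fun x => HeapDesc w (H.label x)) (H.eq_edge_iff_of_adj hw hw') hp

include H in
theorem isTree : G.IsTree := by
  refine ⟨H.connected, fun v p hp => ?_⟩
  cases p with
  | nil => exact SimpleGraph.Walk.not_isCycle_nil hp
  | @cons _ u _ h p =>
    obtain ⟨w, hw, hw', hwe⟩ := H.exists_edge_eq (G.mem_edgeSet.2 h)
    have hmem : H.edge w ∈ (SimpleGraph.Walk.cons h p).edges := by simp [hwe]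
    exact (H.edge_mem_edges_iff hw hw' hp.isTrail).1 hmem Iff.rfl

theorem exists_path (x y : ℕ) (hx : 1 ≤ x) (hx' : x < 2 ^ (d + 1)) (hy : 1 ≤ y)
    (hy' : y < 2 ^ (d + 1)) : ∃ P : GraphPath G, ∀ w, 2 ≤ w → w < 2 ^ (d + 1) →
      (H.edge w ∈ P.edges ↔ ¬ (HeapDesc w x ↔ HeapDesc w y)) := by
  obtain ⟨p, hp⟩ := H.connected.exists_isPath (H.vert x) (H.vert y)
  refine ⟨⟨p.toSubgraph, _, _, p, hp, rfl⟩, fun w hw hw' => ?_⟩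
  refine p.mem_edges_toSubgraph.trans ?_
  rw [H.edge_mem_edges_iff hw hw' hp.isTrail, H.label_vert x hx hx', H.label_vert y hy hy']

theorem log_label_le {u v : V} (p : G.Walk u v) :
    Nat.log 2 (H.label v) ≤ Nat.log 2 (H.label u) + p.length := by
  induction p with
  | nil => simp
  | @cons u v w h p ih =>
    rw [SimpleGraph.Walk.length_cons]
    suffices Nat.log 2 (H.label v) ≤ Nat.log 2 (H.label u) + 1 by omega
    have := H.label_pos u
    rcases (H.adj_iff u v).1 h with h | h
    · rw [h, ← Nat.log_of_one_lt_of_le one_lt_two (by omega)]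
    · rw [h]
      exact (Nat.log_mono_right (Nat.div_le_self _ _)).trans (Nat.le_succ _)

theorem dist_root (v : V) : G.dist (H.vert 1) v = Nat.log 2 (H.label v) := by
  apply le_antisymm
  · obtain ⟨p, hp⟩ := H.exists_walk_length_eq_log (H.label_pos v) (H.label_lt v)
    rw [← hp, ← p.length_copy rfl (H.vert_label v)]
    exact G.dist_le _
  · obtain ⟨p, hp⟩ := H.connected.exists_walk_length_eq_dist (H.vert 1) v
    have := H.log_label_le p
    rwa [H.label_vert 1 le_rfl (Nat.one_lt_two_pow (by omega)), Nat.log_one_right, zero_add,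
      hp] at this

include H in
theorem isCompleteBinaryTree (hd : 1 ≤ d) : IsCompleteBinaryTree G := by
  have hd2 : 2 ^ 1 ≤ 2 ^ d := Nat.pow_le_pow_right two_pos hd
  have edge_ne {w x : ℕ} (hw : 2 ≤ w) (hw' : w < 2 ^ (d + 1)) (hx : 2 ≤ x) (hx' : x < 2 ^ (d + 1))
      (hwx : w ≠ x) : H.edge w ≠ H.edge x := H.edge_injOn.ne ⟨hw, hw'⟩ ⟨hx, hx'⟩ hwx
  have deg_root : deg G (H.vert 1) = 2 := by
    rw [deg_eq_ncard_incidenceSet, H.incidenceSet_root hd, Set.ncard_pair (edge_ne _ _ _ _ _)] <;>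
      omega
  have deg_inner {m : ℕ} (hm : 2 ≤ m) (hm' : m < 2 ^ d) : deg G (H.vert m) = 3 := by
    rw [deg_eq_ncard_incidenceSet, H.incidenceSet_of_lt_two_pow hm hm', Set.ncard_eq_three]
    exact ⟨_, _, _, edge_ne (by omega) (by omega) (by omega) (by omega) (by omega),
      edge_ne (by omega) (by omega) (by omega) (by omega) (by omega),
      edge_ne (by omega) (by omega) (by omega) (by omega) (by omega), rfl⟩
  have deg_leaf {m : ℕ} (hm : 2 ^ d ≤ m) (hm' : m < 2 ^ (d + 1)) : deg G (H.vert m) = 1 := by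
    rw [deg_eq_ncard_incidenceSet, H.incidenceSet_of_two_pow_le (by omega) hm hm',
      Set.ncard_singleton]
  refine ⟨H.isTree, H.vert 1, Or.inr deg_root, fun v hv => ?_, d, fun v hv => ?_⟩ <;>
    have hpos := H.label_pos v <;> have hlt := H.label_lt v <;> rw [← H.vert_label v] at hv ⊢
  · rw [Ne, H.vert_eq_vert_iff hpos hlt le_rfl (by omega)] at hv
    rcases lt_or_ge (H.label v) (2 ^ d) with h | h
    exacts [Or.inr (deg_inner (by omega) h), Or.inl (deg_leaf h hlt)]
  · rw [H.dist_root, H.vert_label]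
    rcases lt_or_ge (H.label v) (2 ^ d) with h | h
    · obtain h1 | h1 : H.label v = 1 ∨ 2 ≤ H.label v := by omega
      · rw [h1, deg_root] at hv; omega
      · rw [deg_inner h1 h] at hv; omega
    · exact (Nat.log_eq_iff (Or.inl (by omega))).2 ⟨h, hlt⟩

end HeapLabelling

theorem sum_Ico_two_mul (f : ℕ → ℕ) {a b : ℕ} (hab : a ≤ b) :
    ∑ x ∈ Finset.Ico (2 * a) (2 * b), f x = ∑ x ∈ Finset.Ico a b, (f (2 * x) + f (2 * x + 1)) := by
  induction b, hab using Nat.le_induction with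
  | base => simp
  | succ b hab ih =>
    rw [Finset.sum_Ico_succ_top hab, ← ih, show 2 * (b + 1) = 2 * b + 1 + 1 by ring,
      Finset.sum_Ico_succ_top (by omega), Finset.sum_Ico_succ_top (by omega), add_assoc]

namespace HeapLabelling

section LowerBound

variable {V ι κ : Type*} {G : SimpleGraph V} {d : ℕ} (H : HeapLabelling G d) [Fintype ι]
  {P : ι → GraphPath G}

/-- The number of ends of paths of the family `P` in the uppermost `j + 1` levels of the subtree
rooted at the vertex labelled `x`. -/
def endsBelow (P : ι → GraphPath G) : ℕ → ℕ → ℕ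
  | 0, x => #(endsAt P (H.vert x))
  | j + 1, x => #(endsAt P (H.vert x)) + (endsBelow P j (2 * x) + endsBelow P j (2 * x + 1))

/-- The subtree of height `j` below the edge `H.edge x` meets the family `P` as economically as
possible: every edge, including `H.edge x`, is on two paths, and no path ends at an inner vertex. -/
def IsTight (P : ι → GraphPath G) : ℕ → ℕ → Prop
  | 0, x => #(through P (H.edge x)) = 2
  | j + 1, x => #(through P (H.edge x)) = 2 ∧ #(endsAt P (H.vert x)) = 0 ∧
      IsTight P j (2 * x) ∧ IsTight P j (2 * x + 1)

variable {H}

theorem IsTight.card_through {j x : ℕ} (h : H.IsTight P j x) : #(through P (H.edge x)) = 2 := by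
  cases j with
  | zero => exact h
  | succ j => exact h.1

theorem four_le_card_through_add (hP : Separates P) {x : ℕ} (hx : 2 ≤ x) (hx' : x < 2 ^ d) :
    4 ≤ #(through P (H.edge (2 * x))) + #(through P (H.edge (2 * x + 1))) +
        #(endsAt P (H.vert x)) ∧
      (#(through P (H.edge (2 * x))) + #(through P (H.edge (2 * x + 1))) +
          #(endsAt P (H.vert x)) = 4 →
        #(through P (H.edge x)) = 2 ∧ #(through P (H.edge (2 * x))) = 2 ∧
          #(through P (H.edge (2 * x + 1))) = 2 ∧ #(endsAt P (H.vert x)) = 0) := by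
  have edge_ne {w y : ℕ} (hw : 2 ≤ w ∧ w < 2 ^ (d + 1)) (hy : 2 ≤ y ∧ y < 2 ^ (d + 1))
      (hwy : w ≠ y) : H.edge w ≠ H.edge y := H.edge_injOn.ne hw hy hwy
  exact hP.four_le_card_through_add_card_through_add_card_endsAt
    (H.incidenceSet_of_lt_two_pow hx hx') (edge_ne (by omega) (by omega) (by omega))
    (edge_ne (by omega) (by omega) (by omega)) (edge_ne (by omega) (by omega) (by omega))

theorem four_le_endsBelow_one (hP : Separates P) {x : ℕ} (hx : 2 ≤ x) (hdx : 2 ^ d ≤ 2 * x)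
    (hx' : x < 2 ^ d) :
    4 ≤ H.endsBelow P 1 x ∧ (H.endsBelow P 1 x = 4 → H.IsTight P 1 x) := by
  obtain ⟨hfour, heq⟩ := four_le_card_through_add (H := H) hP hx hx'
  have through_le_ends {y : ℕ} (hy : 2 * x ≤ y) (hy' : y ≤ 2 * x + 1) :
      #(through P (H.edge y)) ≤ #(endsAt P (H.vert y)) :=
    Finset.card_le_card (through_subset_endsAt
      (H.incidenceSet_of_two_pow_le (by omega) (by omega) (by omega)))
  have hleft := through_le_ends (y := 2 * x) le_rfl (by omega)
  have hright := through_le_ends (y := 2 * x + 1) (by omega) le_rfl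
  simp only [endsBelow, IsTight]
  omega

theorem two_pow_le_endsBelow (hP : Separates P) {j l x : ℕ} (hl : 1 ≤ l) (hlj : l + (j + 1) = d)
    (hx : 2 ^ l ≤ x) (hx' : x < 2 ^ (l + 1)) :
    2 ^ (j + 2) ≤ H.endsBelow P (j + 1) x ∧
      (H.endsBelow P (j + 1) x = 2 ^ (j + 2) → H.IsTight P (j + 1) x) := by
  have h2x : 2 ≤ x := (Nat.le_self_pow (by omega) 2).trans hx
  have hxd : x < 2 ^ d := hx'.trans_le (Nat.pow_le_pow_right two_pos (by omega))
  induction j generalizing l x with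
  | zero =>
    obtain rfl : d = l + 1 := hlj.symm
    exact four_le_endsBelow_one hP h2x (by omega) hxd
  | succ j ih =>
    have hpow : 2 ^ (j + 1 + 2) = 2 * 2 ^ (j + 2) := pow_succ' 2 _
    have hld : 2 ^ (l + 1 + 1) ≤ 2 ^ d := Nat.pow_le_pow_right two_pos (by omega)
    obtain ⟨hleft, hleft_eq⟩ := ih (l := l + 1) (x := 2 * x) (by omega) (by omega) (by omega)
      (by omega) (by omega) (by omega)
    obtain ⟨hright, hright_eq⟩ := ih (l := l + 1) (x := 2 * x + 1) (by omega) (by omega)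
      (by omega) (by omega) (by omega) (by omega)
    refine ⟨by rw [endsBelow]; omega, fun h => ?_⟩
    rw [endsBelow] at h
    have tight_left := hleft_eq (by omega)
    have tight_right := hright_eq (by omega)
    have := tight_left.card_through
    have := tight_right.card_through
    exact ⟨((four_le_card_through_add hP h2x hxd).2 (by omega)).1, by omega, tight_left,
      tight_right⟩

theorem IsTight.exists_finset {j l x : ℕ} (h : H.IsTight P j x) (hl : 1 ≤ l) (hlj : l + j = d)
    (hx : 2 ^ l ≤ x) (hx' : x < 2 ^ (l + 1)) {i : ι} (hi : i ∈ through P (H.edge x)) :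
    ∃ s : Finset ℕ, #s = j + 1 ∧ ∀ w ∈ s, x ≤ w ∧ w < 2 ^ (d + 1) ∧
      i ∈ through P (H.edge w) ∧ #(through P (H.edge w)) = 2 := by
  have h2x : 2 ≤ x := (Nat.le_self_pow (by omega) 2).trans hx
  have hxd : x < 2 ^ (d + 1) := hx'.trans_le (Nat.pow_le_pow_right two_pos (by omega))
  induction j generalizing l x with
  | zero =>
    refine ⟨{x}, rfl, fun w hw => ?_⟩
    rw [Finset.mem_singleton.1 hw]
    exact ⟨le_rfl, hxd, hi, h⟩
  | succ j ih =>
    have hxd' : x < 2 ^ d := hx'.trans_le (Nat.pow_le_pow_right two_pos (by omega))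
    have hxe : H.vert x ∈ H.edge x := Sym2.mem_mk_left _ _
    obtain ⟨f, hf, hfx, hif⟩ := exists_ne_mem_through hi hxe
      (by rw [Finset.card_eq_zero.1 h.2.1]; exact Finset.notMem_empty i)
    rw [H.incidenceSet_of_lt_two_pow h2x hxd'] at hf
    obtain ⟨y, hyx, hy, hiy⟩ :
        ∃ y, (y = 2 * x ∨ y = 2 * x + 1) ∧ H.IsTight P j y ∧ i ∈ through P (H.edge y) := by
      rcases hf with rfl | rfl | rfl
      exacts [absurd rfl hfx, ⟨_, Or.inl rfl, h.2.2.1, hif⟩, ⟨_, Or.inr rfl, h.2.2.2, hif⟩]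
    have hyd : y < 2 ^ (d + 1) :=
      lt_of_lt_of_le (by omega) (Nat.pow_le_pow_right two_pos (by omega : l + 1 + 1 ≤ d + 1))
    obtain ⟨s, hs, hsy⟩ := ih hy (l := l + 1) (by omega) (by omega) (by omega) (by omega) hiy
      (by omega) hyd
    have hxs : x ∉ s := fun hxs => by have := (hsy x hxs).1; omega
    refine ⟨insert x s, by rw [Finset.card_insert_of_notMem hxs, hs], ?_⟩
    rw [Finset.forall_mem_insert]
    refine ⟨⟨le_rfl, hxd, hi, h.1⟩, fun w hw => ?_⟩
    have hyw := (hsy w hw).1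
    exact ⟨by omega, (hsy w hw).2⟩

theorem IsTight.lt_card [Fintype κ] {c : ι → κ} (hP : RainbowSeparates P c) {j l x : ℕ}
    (h : H.IsTight P j x) (hl : 1 ≤ l) (hlj : l + j = d) (hx : 2 ^ l ≤ x)
    (hx' : x < 2 ^ (l + 1)) : j < Fintype.card κ := by
  classical
  have h2x : 2 ≤ x := (Nat.le_self_pow (by omega) 2).trans hx
  obtain ⟨i, hi⟩ : (through P (H.edge x)).Nonempty :=
    Finset.card_pos.1 (by rw [h.card_through]; norm_num)
  obtain ⟨s, hs, hsx⟩ := h.exists_finset hl hlj hx hx' hi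
  have hinj : Set.InjOn H.edge s :=
    H.edge_injOn.mono fun w hw => Set.mem_Ico.2 ⟨h2x.trans (hsx w hw).1, (hsx w hw).2.1⟩
  have hcard := hP.card_le_of_card_through_eq_two (i := i) (s := s.image H.edge)
    (Finset.forall_mem_image.2 fun w hw => (hsx w hw).2.2.1)
    (Finset.forall_mem_image.2 fun w hw => (hsx w hw).2.2.2)
  rw [Finset.card_image_of_injOn hinj, hs] at hcard
  omega

theorem sum_endsBelow (P : ι → GraphPath G) (j l : ℕ) :
    ∑ x ∈ Finset.Ico (2 ^ l) (2 ^ (l + 1)), H.endsBelow P j x =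
      ∑ x ∈ Finset.Ico (2 ^ l) (2 ^ (l + j + 1)), #(endsAt P (H.vert x)) := by
  induction j generalizing l with
  | zero => rfl
  | succ j ih =>
    have hle : 2 ^ l ≤ 2 ^ (l + 1) := Nat.pow_le_pow_right two_pos (by omega)
    have hlast : 2 ^ (l + 1) ≤ 2 ^ (l + 1 + j + 1) := Nat.pow_le_pow_right two_pos (by omega)
    simp only [endsBelow]
    rw [Finset.sum_add_distrib, ← sum_Ico_two_mul _ hle, ← pow_succ', ← pow_succ', ih,
      Finset.sum_Ico_consecutive _ hle hlast, show l + 1 + j = l + (j + 1) by omega]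

theorem two_pow_mul_le_two_mul_card {j l b : ℕ} (hlj : l + j = d)
    (hb : ∀ x, 2 ^ l ≤ x → x < 2 ^ (l + 1) → b ≤ H.endsBelow P j x) :
    2 ^ l * b ≤ 2 * Fintype.card ι := by
  classical
  subst hlj
  have hinj : Set.InjOn H.vert (Finset.Ico (2 ^ l) (2 ^ (l + j + 1)) : Finset ℕ) := by
    intro m hm n hn h
    rw [Finset.mem_coe, Finset.mem_Ico] at hm hn
    have := Nat.one_le_two_pow (n := l)
    exact (H.vert_eq_vert_iff (by omega) hm.2 (by omega) hn.2).1 h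
  calc 2 ^ l * b = ∑ _x ∈ Finset.Ico (2 ^ l) (2 ^ (l + 1)), b := by
        rw [Finset.sum_const, Nat.card_Ico, smul_eq_mul, pow_succ', two_mul, Nat.add_sub_cancel]
    _ ≤ ∑ x ∈ Finset.Ico (2 ^ l) (2 ^ (l + 1)), H.endsBelow P j x :=
        Finset.sum_le_sum fun x hx => hb x (Finset.mem_Ico.1 hx).1 (Finset.mem_Ico.1 hx).2
    _ = ∑ v ∈ (Finset.Ico (2 ^ l) (2 ^ (l + j + 1))).image H.vert, #(endsAt P v) := by
        rw [sum_endsBelow, Finset.sum_image hinj]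
    _ ≤ 2 * Fintype.card ι := sum_card_endsAt_le P _

variable (H)

include H in
theorem two_pow_le_card_of_isStronglySeparating (hd : 2 ≤ d) {S : Finset (GraphPath G)}
    (hS : IsStronglySeparating S) : 2 ^ d ≤ #S := by
  obtain ⟨l, rfl⟩ : ∃ l, d = l + 1 := ⟨d - 1, by omega⟩
  have h := two_pow_mul_le_two_mul_card (H := H) (j := 1) rfl fun x hx hx' =>
    (two_pow_le_endsBelow hS.separates (j := 0) (by omega) rfl hx hx').1
  rw [Fintype.card_coe] at h
  rw [pow_succ']
  omega

include H in
theorem two_pow_mul_le_two_mul_card_of_isRSPS {k l : ℕ} (hk : 1 ≤ k) (hl : 1 ≤ l)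
    (hlk : l + k = d) {S : Multiset (GraphPath G)} (hS : IsRSPS k S) :
    2 ^ l * (2 ^ (k + 1) + 1) ≤ 2 * S.card := by
  obtain ⟨P, c, hPc⟩ := hS.exists_rainbowSeparates
  obtain ⟨j, rfl⟩ : ∃ j, k = j + 1 := ⟨k - 1, by omega⟩
  rw [← Fintype.card_fin S.card]
  refine two_pow_mul_le_two_mul_card (H := H) (P := P) hlk fun x hx hx' => ?_
  obtain ⟨hle, htight⟩ := two_pow_le_endsBelow (H := H) hPc.separates hl hlk hx hx'
  refine lt_of_le_of_ne hle fun heq => ?_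
  have := (htight heq.symm).lt_card hPc hl hlk hx hx'
  rw [Fintype.card_fin] at this
  exact this.false

end LowerBound

end HeapLabelling

section GapPaths

/-- The edge label `w` belongs to the block of height `h` at `R`: the subtree of height `h` rooted
at `R` together with the edge from `R` to its parent. -/
def InBlock (h R w : ℕ) : Prop := ∃ s t, s + t = h ∧ w / 2 ^ s = R

/-- The left end of the `g`-th gap path of a block. The leaves of the block and the parent `R / 2`
of its root are its terminals, in the cyclic order of a plane drawing; the gap paths, numbered from
`0` to `2 ^ h`, join consecutive terminals. -/
def gapLeft (h R g : ℕ) : ℕ := if g = 0 then R / 2 else R * 2 ^ h + g - 1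

/-- The right end of the `g`-th gap path of a block. -/
def gapRight (h R g : ℕ) : ℕ := if g < 2 ^ h then R * 2 ^ h + g else R / 2

/-- The edge labelled `w` is on the `g`-th gap path of the block of height `h` at `R`. -/
def OnGapPath (h R g w : ℕ) : Prop :=
  ¬ (HeapDesc w (gapLeft h R g) ↔ HeapDesc w (gapRight h R g))

variable {h R g w : ℕ}

theorem InBlock.le (hw : InBlock h R w) : R ≤ w := by
  obtain ⟨s, t, -, rfl⟩ := hw
  exact Nat.div_le_self _ _

theorem heapDesc_iff_of_not_inBlock (hw : ¬ InBlock h R w) {x : ℕ} (hx : x / 2 ^ h = R) :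
    HeapDesc w x ↔ HeapDesc w (R / 2) := by
  have div_parent (j : ℕ) : x / 2 ^ (h + (j + 1)) = R / 2 / 2 ^ j := by
    rw [pow_add, ← Nat.div_div_eq_div_mul, hx, pow_succ', ← Nat.div_div_eq_div_mul]
  constructor
  · rintro ⟨j, rfl⟩
    obtain ⟨s, rfl⟩ | ⟨i, rfl⟩ : (∃ s, h = j + s) ∨ ∃ i, j = h + (i + 1) := by
      rcases le_or_gt j h with hj | hj
      exacts [Or.inl ⟨h - j, by omega⟩, Or.inr ⟨j - h - 1, by omega⟩]
    · refine absurd ⟨s, j, add_comm s j, ?_⟩ hw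
      rw [Nat.div_div_eq_div_mul, ← pow_add, hx]
    · exact ⟨i, (div_parent i).symm⟩
  · rintro ⟨j, rfl⟩
    exact ⟨h + (j + 1), div_parent j⟩

theorem eq_of_div_two_pow_eq {x a b : ℕ} (hab : x / 2 ^ a = x / 2 ^ b) (hx : x / 2 ^ a ≠ 0) :
    a = b := by
  have not_lt {a b : ℕ} (hab : x / 2 ^ a = x / 2 ^ b) (hx : x / 2 ^ a ≠ 0) : ¬ a < b := by
    intro hlt
    obtain ⟨c, rfl⟩ := Nat.exists_eq_add_of_lt hlt
    rw [add_assoc, pow_add, ← Nat.div_div_eq_div_mul] at hab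
    have hlt := Nat.div_lt_self (Nat.pos_of_ne_zero hx) (Nat.one_lt_two_pow c.succ_ne_zero)
    exact hlt.ne' hab
  have := not_lt hab hx
  have := not_lt hab.symm (hab ▸ hx)
  omega

theorem heapDesc_iff_of_div_two_pow_eq {s t : ℕ} (hw : w / 2 ^ s = R) (hR : 1 ≤ R) {x : ℕ}
    (hx : x / 2 ^ (s + t) = R) : HeapDesc w x ↔ w * 2 ^ t ≤ x ∧ x < (w + 1) * 2 ^ t := by
  rw [← Nat.le_div_iff_mul_le (by positivity), ← Nat.div_lt_iff_lt_mul (by positivity),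
    Nat.lt_succ_iff, ← le_antisymm_iff, eq_comm]
  refine ⟨fun ⟨j, hj⟩ => ?_, fun h => ⟨t, h⟩⟩
  obtain rfl : j = t := by
    have hsj : x / 2 ^ (s + j) = R := by
      rw [add_comm, pow_add, ← Nat.div_div_eq_div_mul, hj, hw]
    have := eq_of_div_two_pow_eq (hsj.trans hx.symm) (by omega)
    omega
  exact hj

theorem not_onGapPath_of_not_inBlock (hw : ¬ InBlock h R w) (hg : g ≤ 2 ^ h) :
    ¬ OnGapPath h R g w := by
  have leaf {x : ℕ} (hx : R * 2 ^ h ≤ x) (hx' : x < (R + 1) * 2 ^ h) :=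
    heapDesc_iff_of_not_inBlock hw (Nat.div_eq_of_lt_le hx hx')
  rw [add_one_mul] at leaf
  have hpos : 0 < 2 ^ h := by positivity
  have hleft : HeapDesc w (gapLeft h R g) ↔ HeapDesc w (R / 2) := by
    unfold gapLeft
    split_ifs
    exacts [Iff.rfl, leaf (by omega) (by omega)]
  have hright : HeapDesc w (gapRight h R g) ↔ HeapDesc w (R / 2) := by
    unfold gapRight
    split_ifs
    exacts [leaf (by omega) (by omega), Iff.rfl]
  exact fun hne => hne (hleft.trans hright.symm)

theorem onGapPath_iff {s t : ℕ} (hw : w / 2 ^ s = R) (hR : 1 ≤ R) (hg : g ≤ 2 ^ (s + t)) :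
    OnGapPath (s + t) R g w ↔
      R * 2 ^ (s + t) + g = w * 2 ^ t ∨ R * 2 ^ (s + t) + g = (w + 1) * 2 ^ t := by
  have leaf {x : ℕ} (hx : R * 2 ^ (s + t) ≤ x) (hx' : x < (R + 1) * 2 ^ (s + t)) :=
    heapDesc_iff_of_div_two_pow_eq hw hR (Nat.div_eq_of_lt_le hx hx')
  have hlow : R * 2 ^ (s + t) ≤ w * 2 ^ t := by
    rw [pow_add, ← mul_assoc, ← hw]
    exact Nat.mul_le_mul_right _ (Nat.div_mul_le_self _ _)
  have hhigh : (w + 1) * 2 ^ t ≤ (R + 1) * 2 ^ (s + t) := by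
    rw [pow_add, ← mul_assoc, ← hw]
    exact Nat.mul_le_mul_right _ (Nat.lt_mul_of_div_lt (Nat.lt_succ_self _) (by positivity))
  have hparent : ¬ HeapDesc w (R / 2) := fun h => by
    have := h.le
    have := (show InBlock (s + t) R w from ⟨s, t, rfl, hw⟩).le
    omega
  have hpos : 0 < 2 ^ t := by positivity
  simp only [add_one_mul] at leaf hhigh ⊢
  unfold OnGapPath gapLeft gapRight
  split_ifs with hg0 hlast hlast
  · rw [iff_false_left hparent, leaf (by omega) (by omega)]
    omega
  · omega
  · rw [leaf (by omega) (by omega), leaf (by omega) (by omega)]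
    omega
  · rw [iff_false_right hparent, leaf (by omega) (by omega)]
    omega

theorem InBlock.exists_onGapPath_iff (hw : InBlock h R w) (hR : 1 ≤ R) :
    ∃ a t, R * 2 ^ h + a = w * 2 ^ t ∧ a + 2 ^ t ≤ 2 ^ h ∧
      ∀ g ≤ 2 ^ h, (OnGapPath h R g w ↔ g = a ∨ g = a + 2 ^ t) := by
  obtain ⟨s, t, rfl, hw⟩ := hw
  have hlow : R * 2 ^ (s + t) ≤ w * 2 ^ t := by
    rw [pow_add, ← mul_assoc, ← hw]
    exact Nat.mul_le_mul_right _ (Nat.div_mul_le_self _ _)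
  have hhigh : (w + 1) * 2 ^ t ≤ (R + 1) * 2 ^ (s + t) := by
    rw [pow_add, ← mul_assoc, ← hw]
    exact Nat.mul_le_mul_right _ (Nat.lt_mul_of_div_lt (Nat.lt_succ_self _) (by positivity))
  rw [add_one_mul, add_one_mul] at hhigh
  refine ⟨w * 2 ^ t - R * 2 ^ (s + t), t, by omega, by omega, fun g hg => ?_⟩
  rw [onGapPath_iff hw hR hg, add_one_mul]
  omega

theorem InBlock.eq_of_onGapPath_iff {w' : ℕ} (hw : InBlock h R w) (hw' : InBlock h R w')
    (hR : 1 ≤ R) (heq : ∀ g ≤ 2 ^ h, (OnGapPath h R g w ↔ OnGapPath h R g w')) : w = w' := by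
  obtain ⟨a, t, hat, hle, hgap⟩ := hw.exists_onGapPath_iff hR
  obtain ⟨a', t', hat', hle', hgap'⟩ := hw'.exists_onGapPath_iff hR
  have hiff (g : ℕ) (hg : g ≤ 2 ^ h) : g = a ∨ g = a + 2 ^ t ↔ g = a' ∨ g = a' + 2 ^ t' := by
    rw [← hgap g hg, ← hgap' g hg, heq g hg]
  have hpos : 0 < 2 ^ t := by positivity
  have hpos' : 0 < 2 ^ t' := by positivity
  have := hiff a (by omega)
  have := hiff a' (by omega)
  have := hiff (a + 2 ^ t) hle
  obtain rfl : t = t' := Nat.pow_right_injective le_rfl (show 2 ^ t = 2 ^ t' by omega)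
  exact Nat.eq_of_mul_eq_mul_right hpos (show w * 2 ^ t = w' * 2 ^ t by omega)

theorem InBlock.exists_ne_onGapPath_iff (hw : InBlock h R w) (hR : 1 ≤ R) :
    ∃ a b : Fin (2 ^ h + 1), a ≠ b ∧ ∀ g : Fin (2 ^ h + 1), OnGapPath h R g w ↔ g = a ∨ g = b := by
  obtain ⟨a, t, -, hle, hgap⟩ := hw.exists_onGapPath_iff hR
  have hpos : 0 < 2 ^ t := by positivity
  refine ⟨⟨a, by omega⟩, ⟨a + 2 ^ t, by omega⟩, fun hab => ?_, fun g => ?_⟩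
  · rw [Fin.mk.injEq] at hab
    omega
  · rw [hgap g (Nat.lt_succ_iff.1 g.2), Fin.ext_iff, Fin.ext_iff]

theorem gapLeft_mem_Ico {N : ℕ} (hR : 2 ≤ R) (hN : (R + 1) * 2 ^ h ≤ N) (hg : g ≤ 2 ^ h) :
    gapLeft h R g ∈ Set.Ico 1 N := by
  have hpos : 0 < 2 ^ h := by positivity
  have : R * 1 ≤ R * 2 ^ h := Nat.mul_le_mul_left _ hpos
  rw [add_one_mul] at hN
  unfold gapLeft
  split_ifs <;> constructor <;> omega

theorem gapRight_mem_Ico {N : ℕ} (hR : 2 ≤ R) (hN : (R + 1) * 2 ^ h ≤ N) :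
    gapRight h R g ∈ Set.Ico 1 N := by
  have hpos : 0 < 2 ^ h := by positivity
  have : R * 1 ≤ R * 2 ^ h := Nat.mul_le_mul_left _ hpos
  rw [add_one_mul] at hN
  unfold gapRight
  split_ifs <;> constructor <;> omega

end GapPaths

/-- The roots `R` of blocks of heights `ht R` that partition the edges of a complete binary tree of
depth `d`, the leaves of the blocks being at depth at most `d`. -/
structure IsBlockDecomposition (d : ℕ) (B : Finset ℕ) (ht : ℕ → ℕ) : Prop where
  two_le : ∀ R ∈ B, 2 ≤ R
  le : ∀ R ∈ B, (R + 1) * 2 ^ ht R ≤ 2 ^ (d + 1)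
  cover : ∀ w, 2 ≤ w → w < 2 ^ (d + 1) → ∃ R ∈ B, InBlock (ht R) R w
  unique : ∀ w, 2 ≤ w → w < 2 ^ (d + 1) → ∀ R ∈ B, ∀ R' ∈ B,
    InBlock (ht R) R w → InBlock (ht R') R' w → R = R'

/-- The family `P`, indexed by the pairs of a block root `R` and a number `g`, lists the gap paths
of the blocks. -/
def IsGapPathFamily {V : Type*} {G : SimpleGraph V} {d : ℕ} (H : HeapLabelling G d) {B : Finset ℕ}
    {ht : ℕ → ℕ} (P : (Σ R : B, Fin (2 ^ ht R + 1)) → GraphPath G) : Prop :=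
  ∀ i w, 2 ≤ w → w < 2 ^ (d + 1) →
    (H.edge w ∈ (P i).edges ↔ OnGapPath (ht i.1) i.1 i.2 w)

namespace IsBlockDecomposition

variable {V : Type*} {G : SimpleGraph V} {d : ℕ} {H : HeapLabelling G d} {B : Finset ℕ}
  {ht : ℕ → ℕ} {P : (Σ R : B, Fin (2 ^ ht R + 1)) → GraphPath G} {w R : ℕ}

theorem exists_isGapPathFamily (hB : IsBlockDecomposition d B ht) (H : HeapLabelling G d) :
    ∃ P : (Σ R : B, Fin (2 ^ ht R + 1)) → GraphPath G, IsGapPathFamily H P := by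
  have gapPath (i : Σ R : B, Fin (2 ^ ht R + 1)) : ∃ P : GraphPath G, ∀ w, 2 ≤ w →
      w < 2 ^ (d + 1) → (H.edge w ∈ P.edges ↔ OnGapPath (ht i.1) i.1 i.2 w) := by
    have hleft := gapLeft_mem_Ico (hB.two_le _ i.1.2) (hB.le _ i.1.2) (Nat.lt_succ_iff.1 i.2.2)
    have hright := gapRight_mem_Ico (g := i.2) (hB.two_le _ i.1.2) (hB.le _ i.1.2)
    exact H.exists_path _ _ hleft.1 hleft.2 hright.1 hright.2
  choose P hP using gapPath
  exact ⟨P, hP⟩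

theorem mem_through_edge_iff (hB : IsBlockDecomposition d B ht) (hP : IsGapPathFamily H P)
    (hw : 2 ≤ w) (hw' : w < 2 ^ (d + 1)) (hRB : R ∈ B) (hR : InBlock (ht R) R w)
    (i : Σ R : B, Fin (2 ^ ht R + 1)) :
    i ∈ through P (H.edge w) ↔ i.1 = ⟨R, hRB⟩ ∧ OnGapPath (ht i.1) i.1 i.2 w := by
  rw [mem_through, hP i w hw hw', iff_and_self]
  intro hi
  by_contra hne
  exact not_onGapPath_of_not_inBlock
    (fun hin => hne (Subtype.ext (hB.unique w hw hw' _ i.1.2 _ hRB hin hR)))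
    (Nat.lt_succ_iff.1 i.2.2) hi

theorem card_through_eq_two (hB : IsBlockDecomposition d B ht) (hP : IsGapPathFamily H P)
    {e : Sym2 V} (he : e ∈ G.edgeSet) : #(through P e) = 2 := by
  obtain ⟨w, hw, hw', rfl⟩ := H.exists_edge_eq he
  obtain ⟨R, hRB, hR⟩ := hB.cover w hw hw'
  obtain ⟨a, b, hab, hgap⟩ := hR.exists_ne_onGapPath_iff (one_le_two.trans (hB.two_le R hRB))
  have through_eq : through P (H.edge w) =
      ({a, b} : Finset _).map (Function.Embedding.sigmaMk (⟨R, hRB⟩ : B)) := by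
    ext ⟨R', g⟩
    rw [hB.mem_through_edge_iff hP hw hw' hRB hR, Finset.mem_map]
    constructor
    · rintro ⟨rfl, hg⟩
      exact ⟨g, by simpa using (hgap g).1 hg, rfl⟩
    · rintro ⟨g, hg, ⟨⟩⟩
      exact ⟨rfl, (hgap g).2 (by simpa using hg)⟩
  rw [through_eq, Finset.card_map, Finset.card_pair hab]

theorem fst_eq_of_mem_through (hB : IsBlockDecomposition d B ht) (hP : IsGapPathFamily H P)
    {e : Sym2 V} (he : e ∈ G.edgeSet) {i j : Σ R : B, Fin (2 ^ ht R + 1)}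
    (hi : i ∈ through P e) (hj : j ∈ through P e) : i.1 = j.1 := by
  obtain ⟨w, hw, hw', rfl⟩ := H.exists_edge_eq he
  obtain ⟨R, hRB, hR⟩ := hB.cover w hw hw'
  rw [hB.mem_through_edge_iff hP hw hw' hRB hR] at hi hj
  exact hi.1.trans hj.1.symm

theorem through_injOn (hB : IsBlockDecomposition d B ht) (hP : IsGapPathFamily H P) :
    Set.InjOn (through P) G.edgeSet := by
  intro e he f hf hef
  obtain ⟨w, hw, hw', rfl⟩ := H.exists_edge_eq he
  obtain ⟨x, hx, hx', rfl⟩ := H.exists_edge_eq hf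
  obtain ⟨R, hRB, hR⟩ := hB.cover w hw hw'
  obtain ⟨R', hRB', hR'⟩ := hB.cover x hx hx'
  have hpos : 1 ≤ R := one_le_two.trans (hB.two_le R hRB)
  obtain ⟨a, _, -, hgap⟩ := hR.exists_ne_onGapPath_iff hpos
  have mem_iff (i) := (hB.mem_through_edge_iff hP hw hw' hRB hR i).symm.trans
    ((Finset.ext_iff.1 hef i).trans (hB.mem_through_edge_iff hP hx hx' hRB' hR' i))
  obtain rfl : R = R' :=
    congrArg Subtype.val ((mem_iff ⟨⟨R, hRB⟩, a⟩).1 ⟨rfl, (hgap a).2 (Or.inl rfl)⟩).1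
  refine congrArg H.edge (hR.eq_of_onGapPath_iff hR' hpos fun g hg => ?_)
  simpa using mem_iff ⟨⟨R, hRB⟩, ⟨g, Nat.lt_succ_iff.2 hg⟩⟩

/-- Every edge is on exactly two gap paths, both of its block, and the gap paths of a block get
pairwise distinct colours. -/
theorem exists_isRSPS (hB : IsBlockDecomposition d B ht) (H : HeapLabelling G d) {k : ℕ}
    (hk : ∀ R ∈ B, 2 ^ ht R + 1 ≤ k) :
    ∃ S : Multiset (GraphPath G), IsRSPS k S ∧ S.card = ∑ R ∈ B, (2 ^ ht R + 1) := by
  obtain ⟨P, hP⟩ := hB.exists_isGapPathFamily H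
  refine ⟨_, (rainbowSeparates_of_card_through_eq_two (P := P) (b := Sigma.fst)
    (c := fun i => Fin.castLE (hk i.1 i.1.2) i.2) (fun _ => hB.card_through_eq_two hP)
    (fun _ he _ hi _ hj => hB.fst_eq_of_mem_through hP he hi hj) (hB.through_injOn hP) ?_).isRSPS,
    ?_⟩
  · rintro ⟨R, g⟩ ⟨R', g'⟩ (rfl : R = R') hgg'
    exact congrArg (Sigma.mk R) (Fin.castLE_injective _ hgg')
  · simp [Finset.sum_attach B fun R => 2 ^ ht R + 1]

end IsBlockDecomposition

/-- The heights of the blocks, by their roots, when the tree is cut at depth `q`: single edges above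
that depth, and blocks of height `h` below it. -/
def cutHeight (q h R : ℕ) : ℕ := if R < 2 ^ q then 0 else h

theorem inBlock_cutHeight_iff {q h R w : ℕ} (hq : 1 ≤ q) (hR : R < 2 ^ (q + 1))
    (hw : 1 ≤ w) (hw' : w < 2 ^ (q + h + 1)) :
    InBlock (cutHeight q h R) R w ↔ w / 2 ^ (Nat.log 2 w - q) = R := by
  have hlog : Nat.log 2 w < q + h + 1 := Nat.log_lt_of_lt_pow (by omega) hw'
  have log_div (s : ℕ) : Nat.log 2 (w / 2 ^ s) = Nat.log 2 w - s := Nat.log_div_base_pow 2 w s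
  unfold cutHeight InBlock
  split_ifs with hRq
  · have hlog_lt : Nat.log 2 R < q := Nat.log_lt_of_lt_pow' (by omega) hRq
    constructor
    · rintro ⟨s, t, hst, rfl⟩
      obtain rfl : s = 0 := by omega
      rw [log_div] at hlog_lt
      rw [Nat.sub_eq_zero_of_le (by omega)]
    · rintro rfl
      rw [log_div] at hlog_lt
      exact ⟨0, 0, rfl, by rw [Nat.sub_eq_zero_of_le (by omega)]⟩
  · have hlog_eq : Nat.log 2 R = q := (Nat.log_eq_iff (Or.inl (by omega))).2 ⟨by omega, hR⟩
    constructor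
    · rintro ⟨s, t, -, rfl⟩
      rw [log_div] at hlog_eq
      rw [← hlog_eq, Nat.sub_sub_self (by omega)]
    · intro hwR
      exact ⟨_, h - (Nat.log 2 w - q), by omega, hwR⟩

theorem isBlockDecomposition_cutHeight {q : ℕ} (hq : 1 ≤ q) (h : ℕ) :
    IsBlockDecomposition (q + h) (Finset.Ico 2 (2 ^ (q + 1))) (cutHeight q h) where
  two_le R hR := (Finset.mem_Ico.1 hR).1
  le R hR := by
    have hR' : R + 1 ≤ 2 ^ (q + 1) := (Finset.mem_Ico.1 hR).2
    have hcut : cutHeight q h R ≤ h := by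
      unfold cutHeight
      split_ifs <;> omega
    calc (R + 1) * 2 ^ cutHeight q h R ≤ 2 ^ (q + 1) * 2 ^ h :=
        Nat.mul_le_mul hR' (Nat.pow_le_pow_right two_pos hcut)
      _ = 2 ^ (q + h + 1) := by ring
  cover w hw hw' := by
    have hlog : 1 ≤ Nat.log 2 w := Nat.log_pos one_lt_two hw
    have hlog_div : Nat.log 2 (w / 2 ^ (Nat.log 2 w - q)) = Nat.log 2 w - (Nat.log 2 w - q) :=
      Nat.log_div_base_pow 2 w _
    have hlt : w / 2 ^ (Nat.log 2 w - q) < 2 ^ (q + 1) :=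
      Nat.lt_pow_of_log_lt one_lt_two (by omega)
    refine ⟨_, Finset.mem_Ico.2 ⟨?_, hlt⟩, (inBlock_cutHeight_iff hq hlt (by omega) hw').2 rfl⟩
    by_contra! h
    have := Nat.log_of_lt h
    omega
  unique w hw hw' R hR R' hR' h h' :=
    ((inBlock_cutHeight_iff hq (Finset.mem_Ico.1 hR).2 (by omega) hw').1 h).symm.trans
      ((inBlock_cutHeight_iff hq (Finset.mem_Ico.1 hR').2 (by omega) hw').1 h')

theorem sum_cutHeight {q : ℕ} (hq : 1 ≤ q) (h : ℕ) :
    ∑ R ∈ Finset.Ico 2 (2 ^ (q + 1)), (2 ^ cutHeight q h R + 1) + 4 = 2 ^ q * (2 ^ h + 3) := by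
  have hq2 : 2 ≤ 2 ^ q := Nat.pow_le_pow_right two_pos hq
  have above : ∑ R ∈ Finset.Ico 2 (2 ^ q), (2 ^ cutHeight q h R + 1) = (2 ^ q - 2) * 2 := by
    rw [Finset.sum_congr rfl fun R hR => by rw [cutHeight, if_pos (Finset.mem_Ico.1 hR).2],
      Finset.sum_const, Nat.card_Ico, smul_eq_mul, pow_zero]
  have below : ∑ R ∈ Finset.Ico (2 ^ q) (2 ^ (q + 1)), (2 ^ cutHeight q h R + 1) =
      2 ^ q * (2 ^ h + 1) := by
    rw [Finset.sum_congr rfl fun R hR => by rw [cutHeight, if_neg (Finset.mem_Ico.1 hR).1.not_gt],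
      Finset.sum_const, Nat.card_Ico, smul_eq_mul, pow_succ', two_mul, Nat.add_sub_cancel]
  rw [← Finset.sum_Ico_consecutive _ hq2 (Nat.pow_le_pow_right two_pos (Nat.le_add_right q 1)),
    above, below, mul_add, mul_add]
  omega

theorem HeapLabelling.exists_isRSPS {V : Type*} {G : SimpleGraph V} {q h k : ℕ}
    (H : HeapLabelling G (q + h)) (hq : 1 ≤ q) (hk : 2 ^ h + 1 ≤ k) :
    ∃ S : Multiset (GraphPath G), IsRSPS k S ∧ S.card + 4 = 2 ^ q * (2 ^ h + 3) := by
  obtain ⟨S, hS, hcard⟩ := (isBlockDecomposition_cutHeight hq h).exists_isRSPS H (k := k)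
    fun R _ => by
      unfold cutHeight
      have := Nat.one_le_two_pow (n := h)
      split_ifs <;> omega
  exact ⟨S, hS, by rw [hcard, sum_cutHeight hq]⟩

section RootedTrees

variable {V : Type*} {G : SimpleGraph V} {r u v p q : V}

/-- The children of the vertex `v` of the tree `G` with root `r`. -/
def children (G : SimpleGraph V) (r v : V) : Set V :=
  {u | G.Adj v u ∧ G.dist r u = G.dist r v + 1}

theorem eq_of_mem_children (hG : G.IsTree) (hp : v ∈ children G r p) (hq : v ∈ children G r q) :
    p = q := by
  obtain ⟨a, ha⟩ := hG.connected.exists_walk_length_eq_dist r p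
  obtain ⟨b, hb⟩ := hG.connected.exists_walk_length_eq_dist r q
  have ha' : (a.concat hp.1).IsPath :=
    SimpleGraph.Walk.isPath_of_length_eq_dist _ (by simp [ha, hp.2])
  have hb' : (b.concat hq.1).IsPath :=
    SimpleGraph.Walk.isPath_of_length_eq_dist _ (by simp [hb, hq.2])
  simpa using congrArg SimpleGraph.Walk.penultimate ((hG.existsUnique_path r v).unique ha' hb')

theorem exists_mem_children (hG : G.Connected) (hv : v ≠ r) : ∃ p, v ∈ children G r p := by
  obtain ⟨a, ha⟩ := hG.exists_walk_length_eq_dist v r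
  cases a with
  | nil => exact absurd rfl hv
  | @cons _ p _ h a =>
    have hle := G.dist_le a
    have htri := hG.dist_triangle (u := r) (v := p) (w := v)
    rw [SimpleGraph.Walk.length_cons, SimpleGraph.dist_comm] at ha
    rw [SimpleGraph.dist_comm] at hle
    rw [SimpleGraph.dist_eq_one_iff_adj.2 h.symm] at htri
    exact ⟨p, h.symm, by omega⟩

theorem adj_iff_mem_children (hG : G.IsTree) (r u v : V) :
    G.Adj u v ↔ v ∈ children G r u ∨ u ∈ children G r v := by
  refine ⟨fun h => ?_, fun h => h.elim (·.1) (·.1.symm)⟩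
  rcases hG.dist_eq_dist_add_one_of_adj r h with h' | h'
  exacts [Or.inr ⟨h.symm, h'⟩, Or.inl ⟨h, h'⟩]

theorem ncard_children_root : (children G r r).ncard = deg G r := by
  simp [children, deg, SimpleGraph.neighborSet]

theorem ncard_children_add_one [Finite V] (hG : G.IsTree) (hv : v ≠ r) :
    (children G r v).ncard + 1 = deg G v := by
  obtain ⟨p, hp⟩ := exists_mem_children hG.connected hv
  have hpv : p ∉ children G r v := fun h => by
    have := h.2
    have := hp.2
    omega
  rw [← Set.ncard_insert_of_notMem hpv, deg]
  congr 1
  ext u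
  rw [Set.mem_insert_iff, SimpleGraph.mem_neighborSet, adj_iff_mem_children hG r v u, or_comm]
  exact or_congr_right ⟨fun h => h ▸ hp, fun h => eq_of_mem_children hG h hp⟩

theorem IsCompleteBinaryTree.exists_ncard_children_eq_two [Finite V] [Nontrivial V]
    (hG : IsCompleteBinaryTree G) :
    ∃ r d, (∀ v, G.dist r v ≤ d) ∧ ∀ v, G.dist r v < d → (children G r v).ncard = 2 := by
  obtain ⟨hT, r, hr, hdeg, d, hd⟩ := hG
  have deg_root : deg G r = 2 := hr.resolve_left fun h0 => by
    obtain ⟨y, hy⟩ := hT.connected.preconnected.exists_adj_of_nontrivial r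
    exact (Set.ncard_pos (s := G.neighborSet r)).2 ⟨y, hy⟩ |>.ne' h0
  obtain ⟨x, hx⟩ := Finite.exists_max (fun v => G.dist r v)
  have children_max : children G r x = ∅ := Set.eq_empty_of_forall_notMem fun u hu => by
    have := hx u
    have := hu.2
    omega
  have hxr : x ≠ r := by
    rintro rfl
    rw [← ncard_children_root, children_max, Set.ncard_empty] at deg_root
    omega
  have deg_max : deg G x = 1 := by
    rw [← ncard_children_add_one hT hxr, children_max, Set.ncard_empty]
  refine ⟨r, d, fun v => hd x deg_max ▸ hx v, fun v hv => ?_⟩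
  by_cases hvr : v = r
  · rw [hvr, ncard_children_root, deg_root]
  · have := ncard_children_add_one hT hvr
    rcases hdeg v hvr with h1 | h3
    · exact absurd (hd v h1) hv.ne
    · omega

end RootedTrees

/-- The tree `G` with root `r` has depth at most `d`, and the children of each vertex `v` at depth
less than `d` are `child 0 v` and `child 1 v`. -/
structure IsBinaryChildMap {V : Type*} (G : SimpleGraph V) (r : V) (d : ℕ)
    (child : ℕ → V → V) : Prop where
  isTree : G.IsTree
  dist_le : ∀ v, G.dist r v ≤ d
  child_ne : ∀ v, G.dist r v < d → child 0 v ≠ child 1 v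
  children_eq : ∀ v, G.dist r v < d → children G r v = {child 0 v, child 1 v}

theorem IsCompleteBinaryTree.exists_isBinaryChildMap {V : Type*} {G : SimpleGraph V} [Finite V]
    [Nontrivial V] (hG : IsCompleteBinaryTree G) :
    ∃ r d child, IsBinaryChildMap G r d child := by
  obtain ⟨r, d, hle, htwo⟩ := hG.exists_ncard_children_eq_two
  have exists_pair (v : V) : ∃ a b, G.dist r v < d → a ≠ b ∧ children G r v = {a, b} := by
    by_cases hv : G.dist r v < d
    · obtain ⟨a, b, h⟩ := Set.ncard_eq_two.1 (htwo v hv)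
      exact ⟨a, b, fun _ => h⟩
    · exact ⟨v, v, fun h => absurd h hv⟩
  choose a b hab using exists_pair
  exact ⟨r, d, fun i => if i = 0 then a else b, hG.1, hle, fun v hv => (hab v hv).1,
    fun v hv => (hab v hv).2⟩

/-- The vertex of the binary tree with root `r` and child map `child` at position `m` of the
breadth-first order, which starts with the root at position `1`. -/
def heapVertex {V : Type*} (r : V) (child : ℕ → V → V) (m : ℕ) : V :=
  if m ≤ 1 then r else child (m % 2) (heapVertex r child (m / 2))
termination_by m

section HeapVertex

variable {V : Type*} {G : SimpleGraph V} {r : V} {d m : ℕ} {child : ℕ → V → V}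

theorem heapVertex_one : heapVertex r child 1 = r := by
  rw [heapVertex, if_pos le_rfl]

theorem heapVertex_of_two_le (hm : 2 ≤ m) :
    heapVertex r child m = child (m % 2) (heapVertex r child (m / 2)) := by
  rw [heapVertex, if_neg (by omega)]

namespace IsBinaryChildMap

theorem child_mem_children (h : IsBinaryChildMap G r d child) {v : V} (hv : G.dist r v < d)
    (m : ℕ) : child (m % 2) v ∈ children G r v := by
  rw [h.children_eq v hv]
  rcases Nat.mod_two_eq_zero_or_one m with h0 | h1
  exacts [h0 ▸ Set.mem_insert _ _, h1 ▸ Set.mem_insert_of_mem _ rfl]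

theorem dist_heapVertex (h : IsBinaryChildMap G r d child) (hm : 1 ≤ m) (hm' : m < 2 ^ (d + 1)) :
    G.dist r (heapVertex r child m) = Nat.log 2 m := by
  induction m using Nat.strong_induction_on with | _ m ih
  obtain rfl | hm2 : m = 1 ∨ 2 ≤ m := by omega
  · rw [heapVertex_one, SimpleGraph.dist_self, Nat.log_one_right]
  · have hlog : Nat.log 2 m = Nat.log 2 (m / 2) + 1 := Nat.log_of_one_lt_of_le one_lt_two hm2
    have hlt : Nat.log 2 m < d + 1 := Nat.log_lt_of_lt_pow (by omega) hm'
    have hhalf := ih (m / 2) (by omega) (by omega) (by omega)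
    rw [heapVertex_of_two_le hm2, (h.child_mem_children (by omega) m).2, hhalf, hlog]

theorem dist_heapVertex_half_lt (h : IsBinaryChildMap G r d child) (hm : 2 ≤ m)
    (hm' : m < 2 ^ (d + 1)) : G.dist r (heapVertex r child (m / 2)) < d := by
  have hlog : Nat.log 2 m = Nat.log 2 (m / 2) + 1 := Nat.log_of_one_lt_of_le one_lt_two hm
  have hlt : Nat.log 2 m < d + 1 := Nat.log_lt_of_lt_pow (by omega) hm'
  rw [h.dist_heapVertex (by omega) (by omega)]
  omega

theorem heapVertex_mem_children (h : IsBinaryChildMap G r d child) (hm : 2 ≤ m)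
    (hm' : m < 2 ^ (d + 1)) :
    heapVertex r child m ∈ children G r (heapVertex r child (m / 2)) := by
  rw [heapVertex_of_two_le hm]
  exact h.child_mem_children (h.dist_heapVertex_half_lt hm hm') m

theorem mod_two_eq_of_child_eq (h : IsBinaryChildMap G r d child) {v : V} (hv : G.dist r v < d)
    {n : ℕ} (hmn : child (m % 2) v = child (n % 2) v) : m % 2 = n % 2 := by
  have hne := h.child_ne v hv
  rcases Nat.mod_two_eq_zero_or_one m with hm | hm <;>
    rcases Nat.mod_two_eq_zero_or_one n with hn | hn <;> rw [hm, hn] at hmn ⊢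
  exacts [absurd hmn hne, absurd hmn.symm hne]

theorem heapVertex_injOn (h : IsBinaryChildMap G r d child) :
    Set.InjOn (heapVertex r child) (Set.Ico 1 (2 ^ (d + 1))) := by
  intro m
  induction m using Nat.strong_induction_on with | _ m ih
  rintro ⟨hm, hm'⟩ n ⟨hn, hn'⟩ hmn
  have hlog : Nat.log 2 m = Nat.log 2 n := by
    rw [← h.dist_heapVertex hm hm', ← h.dist_heapVertex hn hn', hmn]
  have two_le_iff (x : ℕ) : 0 < Nat.log 2 x ↔ 2 ≤ x := by
    rw [Nat.log_pos_iff, and_iff_left one_lt_two]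
  obtain ⟨hm1, hn1⟩ | ⟨hm2, hn2⟩ : (m = 1 ∧ n = 1) ∨ (2 ≤ m ∧ 2 ≤ n) := by
    have := two_le_iff m
    have := two_le_iff n
    omega
  · rw [hm1, hn1]
  · have half_eq : heapVertex r child (m / 2) = heapVertex r child (n / 2) :=
      eq_of_mem_children h.isTree (h.heapVertex_mem_children hm2 hm')
        (hmn ▸ h.heapVertex_mem_children hn2 hn')
    have := ih (m / 2) (by omega) ⟨by omega, by omega⟩ ⟨by omega, by omega⟩ half_eq
    rw [heapVertex_of_two_le hm2, heapVertex_of_two_le hn2, ← half_eq] at hmn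
    have := h.mod_two_eq_of_child_eq (h.dist_heapVertex_half_lt hm2 hm') hmn
    omega

theorem heapVertex_surjOn (h : IsBinaryChildMap G r d child) :
    Set.SurjOn (heapVertex r child) (Set.Ico 1 (2 ^ (d + 1))) Set.univ := by
  rintro v -
  induction hl : G.dist r v generalizing v with
  | zero =>
    rw [h.isTree.connected.dist_eq_zero_iff] at hl
    exact ⟨1, ⟨le_rfl, Nat.one_lt_two_pow d.succ_ne_zero⟩, heapVertex_one.trans hl⟩
  | succ l ih =>
    obtain ⟨p, hp⟩ := exists_mem_children (r := r) (v := v) h.isTree.connected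
      (by rintro rfl; simp at hl)
    have hpl : G.dist r p = l := by
      have := hp.2
      omega
    obtain ⟨m, ⟨hm, hm'⟩, rfl⟩ := ih hpl
    have hld : l < d := by
      have := h.dist_le v
      omega
    have hmd : m < 2 ^ d :=
      Nat.lt_pow_of_log_lt one_lt_two (by rwa [← h.dist_heapVertex hm hm', hpl])
    rw [h.children_eq _ (by omega)] at hp
    obtain ⟨i, hi, rfl⟩ : ∃ i < 2, child i (heapVertex r child m) = v := by
      rcases hp with rfl | rfl
      exacts [⟨0, by omega, rfl⟩, ⟨1, by omega, rfl⟩]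
    refine ⟨2 * m + i, ⟨by omega, by rw [pow_succ']; omega⟩, ?_⟩
    rw [heapVertex_of_two_le (by omega), show (2 * m + i) % 2 = i by omega,
      show (2 * m + i) / 2 = m by omega]

theorem heapVertex_mem_children_iff (h : IsBinaryChildMap G r d child) {n : ℕ} (hm : 1 ≤ m)
    (hm' : m < 2 ^ (d + 1)) (hn : 1 ≤ n) (hn' : n < 2 ^ (d + 1)) :
    heapVertex r child n ∈ children G r (heapVertex r child m) ↔ m = n / 2 := by
  constructor
  · intro hmn
    have hn2 : 2 ≤ n := by
      by_contra! hn2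
      obtain rfl : n = 1 := by omega
      have := hmn.2
      rw [heapVertex_one, SimpleGraph.dist_self] at this
      omega
    exact h.heapVertex_injOn ⟨hm, hm'⟩ ⟨by omega, by omega⟩
      (eq_of_mem_children h.isTree hmn (h.heapVertex_mem_children hn2 hn'))
  · rintro rfl
    exact h.heapVertex_mem_children (by omega) hn'

theorem nonempty_heapLabelling (h : IsBinaryChildMap G r d child) :
    Nonempty (HeapLabelling G d) := by
  choose label hlabel using fun v => h.heapVertex_surjOn (Set.mem_univ v)
  exact ⟨{
    label := label
    vert := heapVertex r child
    label_pos := fun v => (hlabel v).1.1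
    label_lt := fun v => (hlabel v).1.2
    vert_label := fun v => (hlabel v).2
    label_vert := fun m hm hm' => h.heapVertex_injOn (hlabel _).1 ⟨hm, hm'⟩ (hlabel _).2
    adj_iff := fun u v => by
      obtain ⟨⟨hu, hu'⟩, hlu⟩ := hlabel u
      obtain ⟨⟨hv, hv'⟩, hlv⟩ := hlabel v
      rw [adj_iff_mem_children h.isTree r, ← h.heapVertex_mem_children_iff hu hu' hv hv',
        ← h.heapVertex_mem_children_iff hv hv' hu hu', hlu, hlv] }⟩

end IsBinaryChildMap

end HeapVertex

theorem IsCompleteBinaryTree.exists_heapLabelling {V : Type*} {G : SimpleGraph V} [Finite V]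
    [Nontrivial V] (hG : IsCompleteBinaryTree G) : ∃ d, Nonempty (HeapLabelling G d) := by
  obtain ⟨r, d, child, h⟩ := hG.exists_isBinaryChildMap
  exact ⟨d, h.nonempty_heapLabelling⟩

theorem rainbowSepNumber_top {V : Type*} (G : SimpleGraph V) : rainbowSepNumber G ⊤ = ssp G :=
  if_pos rfl

theorem rainbowSepNumber_natCast {V : Type*} (G : SimpleGraph V) (k : ℕ) :
    rainbowSepNumber G k =
      sInf {m | ∃ S : Multiset (GraphPath G), IsRSPS k S ∧ S.card = m} := by
  rw [rainbowSepNumber, if_neg (ENat.natCast_ne_top k), ENat.toNat_natCast]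

namespace HeapLabelling

variable {V : Type*} {G : SimpleGraph V} {d k : ℕ}

theorem exists_isRSPS_mul_card_le (H : HeapLabelling G d) (hk : 2 ≤ k) (hkd : k ≤ d) :
    ∃ S : Multiset (GraphPath G), IsRSPS k S ∧ k * S.card ≤ 2 ^ d * (k + 6) := by
  have hle : 2 ^ Nat.log 2 (k - 1) ≤ k - 1 := Nat.pow_log_le_self 2 (by omega)
  have hlt : k - 1 < 2 ^ (Nat.log 2 (k - 1) + 1) := Nat.lt_pow_succ_log_self one_lt_two _
  have hlog : Nat.log 2 (k - 1) < 2 ^ Nat.log 2 (k - 1) := Nat.lt_two_pow_self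
  generalize Nat.log 2 (k - 1) = h at hle hlt hlog
  obtain ⟨q, rfl⟩ : ∃ q, d = q + h := ⟨d - h, by omega⟩
  obtain ⟨S, hS, hcard⟩ := H.exists_isRSPS (k := k) (by omega) (by omega)
  have hk2 : k ≤ 2 * 2 ^ h := by
    rw [pow_succ'] at hlt
    omega
  refine ⟨S, hS, ?_⟩
  calc k * S.card ≤ k * (2 ^ q * (2 ^ h + 3)) := Nat.mul_le_mul_left _ (by omega)
    _ = 2 ^ q * (2 ^ h * k + 3 * k) := by ring
    _ ≤ 2 ^ q * (2 ^ h * k + 3 * (2 * 2 ^ h)) := by gcongr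
    _ = 2 ^ (q + h) * (k + 6) := by ring

theorem ssp_le (H : HeapLabelling G d) (hd : 1 ≤ d) : ssp G ≤ 2 ^ d + 2 := by
  obtain ⟨h, rfl⟩ : ∃ h, d = 1 + h := ⟨d - 1, by omega⟩
  obtain ⟨S, hS, hcard⟩ := H.exists_isRSPS le_rfl le_rfl
  obtain ⟨S', hS', hle⟩ := hS.exists_isStronglySeparating
  have hssp : ssp G ≤ #S' := Nat.sInf_le ⟨S', hS', rfl⟩
  rw [pow_add]
  omega

theorem two_pow_le_ssp (H : HeapLabelling G d) (hd : 2 ≤ d) : 2 ^ d ≤ ssp G := by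
  obtain ⟨S, hS, -⟩ := H.exists_isRSPS_mul_card_le le_rfl hd
  obtain ⟨S', hS', -⟩ := hS.exists_isStronglySeparating
  obtain ⟨T, hT, hcard⟩ := Nat.sInf_mem (s := {m | ∃ S : Finset (GraphPath G),
    IsStronglySeparating S ∧ #S = m}) ⟨_, S', hS', rfl⟩
  rw [ssp, ← hcard]
  exact H.two_pow_le_card_of_isStronglySeparating hd hT

theorem one_add_mul_ssp_le_card (H : HeapLabelling G d) (hk : 1 ≤ k) (hkd : k + 5 ≤ d)
    {S : Multiset (GraphPath G)} (hS : IsRSPS k S) :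
    (1 + 1 / (16 : ℝ) ^ (k + 6)) * ssp G ≤ S.card := by
  obtain ⟨l, rfl⟩ : ∃ l, d = l + k := ⟨d - k, by omega⟩
  have hcard : (2 : ℝ) ^ l * (2 ^ (k + 1) + 1) ≤ 2 * S.card := by
    exact_mod_cast H.two_pow_mul_le_two_mul_card_of_isRSPS hk (by omega) rfl hS
  have hssp : (ssp G : ℝ) ≤ 2 ^ (l + k) + 2 := by
    exact_mod_cast H.ssp_le (by omega)
  have hl : (2 : ℝ) ^ 5 ≤ 2 ^ l := pow_le_pow_right₀ one_le_two (by omega)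
  have hexcess : 1 / (16 : ℝ) ^ (k + 6) * (2 ^ (l + k) + 2) ≤ 2 ^ l / 4 := by
    rw [one_div_mul_eq_div, div_le_iff₀ (by positivity)]
    have h16 : (2 : ℝ) ^ k ≤ 16 ^ k := pow_le_pow_left₀ two_pos.le (by norm_num) k
    have hk1 : (1 : ℝ) ≤ 2 ^ k := one_le_pow₀ one_le_two
    calc (2 : ℝ) ^ (l + k) + 2 ≤ 2 ^ l * 2 ^ k + 2 ^ l * 2 ^ k := by
          rw [pow_add]
          nlinarith
      _ ≤ 2 ^ l * 16 ^ k + 2 ^ l * 16 ^ k := by gcongr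
      _ ≤ 2 ^ l / 4 * 16 ^ (k + 6) := by
          rw [pow_add]
          have : (0 : ℝ) < 2 ^ l * 16 ^ k := by positivity
          linarith
  calc (1 + 1 / (16 : ℝ) ^ (k + 6)) * ssp G
      ≤ (1 + 1 / (16 : ℝ) ^ (k + 6)) * (2 ^ (l + k) + 2) := by gcongr
    _ ≤ 2 ^ (l + k) + 2 + 2 ^ l / 4 := by linarith
    _ ≤ 2 ^ l * (2 ^ (k + 1) + 1) / 2 := by
        rw [pow_add, pow_succ]
        linarith
    _ ≤ S.card := by linarith

theorem one_add_le_ratio (H : HeapLabelling G d) (hk : 2 ≤ k) (hkd : k + 5 ≤ d) :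
    ENNReal.ofReal (1 + 1 / (16 : ℝ) ^ (k + 6)) ≤ ratio G k := by
  have hssp : ssp G ≠ 0 := (Nat.pow_pos two_pos |>.trans_le (H.two_pow_le_ssp (by omega))).ne'
  obtain ⟨S, hS, -⟩ := H.exists_isRSPS_mul_card_le hk (by omega)
  obtain ⟨S', hS', hcard⟩ := Nat.sInf_mem (s := {m | ∃ S : Multiset (GraphPath G),
    IsRSPS k S ∧ S.card = m}) ⟨_, S, hS, rfl⟩
  rw [ratio, rainbowSepNumber_top, rainbowSepNumber_natCast, ← hcard,
    ENNReal.le_div_iff_mul_le (Or.inl (by exact_mod_cast hssp))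
      (Or.inl (ENNReal.natCast_ne_top _)),
    ← ENNReal.ofReal_natCast, ← ENNReal.ofReal_natCast, ← ENNReal.ofReal_mul (by positivity)]
  exact ENNReal.ofReal_le_ofReal (H.one_add_mul_ssp_le_card (by omega) hkd hS')

theorem ratio_le (H : HeapLabelling G d) (hk : 2 ≤ k) (hkd : k ≤ d) :
    ratio G k ≤ ENNReal.ofReal (1 + 6 / k) := by
  have hpow_le : 2 ^ d ≤ ssp G := H.two_pow_le_ssp (by omega)
  have hssp : ssp G ≠ 0 := (Nat.pow_pos two_pos |>.trans_le hpow_le).ne'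
  obtain ⟨S, hS, hcard⟩ := H.exists_isRSPS_mul_card_le hk hkd
  have hle_card : rainbowSepNumber G k ≤ S.card := by
    rw [rainbowSepNumber_natCast]
    exact Nat.sInf_le ⟨S, hS, rfl⟩
  have hmul : (k : ℝ) * rainbowSepNumber G k ≤ ssp G * (k + 6) := by
    exact_mod_cast (Nat.mul_le_mul_left k hle_card).trans
      (hcard.trans (Nat.mul_le_mul_right _ hpow_le))
  have hk0 : (0 : ℝ) < k := by positivity
  rw [ratio, rainbowSepNumber_top, ENNReal.div_le_iff (by exact_mod_cast hssp)
    (ENNReal.natCast_ne_top _), ← ENNReal.ofReal_natCast, ← ENNReal.ofReal_natCast,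
    ← ENNReal.ofReal_mul (by positivity)]
  refine ENNReal.ofReal_le_ofReal ?_
  calc (rainbowSepNumber G k : ℝ) ≤ ssp G * (k + 6) / k := by
        rw [le_div_iff₀ hk0, mul_comm]
        exact hmul
    _ = (1 + 6 / k) * ssp G := by field_simp

end HeapLabelling

/-- The complete binary tree of depth `d`, its vertices being numbered breadth first. -/
def heapGraph (d : ℕ) : SimpleGraph (Fin (2 ^ (d + 1) - 1)) where
  Adj u v := (u : ℕ) + 1 = (v + 1) / 2 ∨ (v : ℕ) + 1 = (u + 1) / 2
  symm := ⟨fun _ _ h => h.symm⟩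
  loopless := ⟨fun u h => by omega⟩

/-- The labelling of `heapGraph d` by the numbers of its vertices, which start from `1` here. -/
def heapGraphLabelling (d : ℕ) : HeapLabelling (heapGraph d) d where
  label v := v + 1
  vert m := ⟨(m - 1) % (2 ^ (d + 1) - 1), Nat.mod_lt _ (by
    have := Nat.one_lt_two_pow d.succ_ne_zero
    omega)⟩
  label_pos v := by omega
  label_lt v := by omega
  vert_label v := Fin.ext (Nat.mod_eq_of_lt v.2)
  label_vert m hm hm' := by
    change (m - 1) % (2 ^ (d + 1) - 1) + 1 = m
    rw [Nat.mod_eq_of_lt (by omega), Nat.sub_add_cancel hm]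
  adj_iff _ _ := Iff.rfl

theorem infinite_completeBinaryTrees : completeBinaryTrees.Infinite := by
  refine Set.infinite_of_injective_forall_mem
    (f := fun d : ℕ => (⟨2 ^ (d + 1 + 1) - 1, heapGraph (d + 1)⟩ : FinGraph))
    (fun a b hab => ?_) fun d => (heapGraphLabelling (d + 1)).isCompleteBinaryTree (by omega)
  have hcard : 2 ^ (a + 1 + 1) - 1 = 2 ^ (b + 1 + 1) - 1 := congrArg Sigma.fst hab
  have ha := Nat.one_le_two_pow (n := a + 1 + 1)
  have hb := Nat.one_le_two_pow (n := b + 1 + 1)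
  have := Nat.pow_right_injective le_rfl (show 2 ^ (a + 1 + 1) = 2 ^ (b + 1 + 1) by omega)
  omega

instance : (cofinite ⊓ 𝓟 completeBinaryTrees).NeBot :=
  infinite_completeBinaryTrees.cofinite_inf_principal_neBot

theorem eventually_of_le_order {A : Set FinGraph} {p : FinGraph → Prop} (n₀ : ℕ)
    (h : ∀ G ∈ A, n₀ ≤ G.1 → p G) : ∀ᶠ G in cofinite ⊓ 𝓟 A, p G := by
  rw [eventually_inf_principal, eventually_cofinite]
  refine (Set.finite_range fun x : Σ i : Fin n₀, SimpleGraph (Fin i) =>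
    (⟨x.1, x.2⟩ : FinGraph)).subset ?_
  rintro ⟨n, G⟩ hG
  obtain ⟨hGA, hGp⟩ := Classical.not_imp.1 hG
  exact ⟨⟨⟨n, not_le.1 fun hn => hGp (h _ hGA hn)⟩, G⟩, rfl⟩

theorem IsCompleteBinaryTree.exists_heapLabelling_of_two_pow_le {n D : ℕ}
    {G : SimpleGraph (Fin n)} (hG : IsCompleteBinaryTree G) (hn : 2 ^ (D + 1) ≤ n) :
    ∃ d, D ≤ d ∧ n + 1 = 2 ^ (d + 1) ∧ Nonempty (HeapLabelling G d) := by
  have htwo : 2 ≤ 2 ^ (D + 1) := Nat.pow_le_pow_right two_pos (Nat.le_add_left 1 D)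
  have : Nontrivial (Fin n) := Fin.nontrivial_iff_two_le.2 (htwo.trans hn)
  obtain ⟨d, ⟨H⟩⟩ := hG.exists_heapLabelling
  have hcard : n = 2 ^ (d + 1) - 1 := (Fintype.card_fin n).symm.trans H.card_eq
  have hlt : D + 1 < d + 1 := (Nat.pow_lt_pow_iff_right one_lt_two).1 (by omega)
  exact ⟨d, by omega, by omega, ⟨H⟩⟩

theorem one_add_mul_rainbowSepNumber_top_le_card {k n : ℕ} (hk : 1 ≤ k) (hn : 2 ^ (k + 6) ≤ n)
    {G : SimpleGraph (Fin n)} (hG : IsCompleteBinaryTree G) {S : Multiset (GraphPath G)}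
    (hS : IsRSPS k S) :
    (1 + 1 / (16 : ℝ) ^ (k + 6)) * rainbowSepNumber G ⊤ ≤ S.card := by
  obtain ⟨d, hkd, -, ⟨H⟩⟩ := hG.exists_heapLabelling_of_two_pow_le (D := k + 5) hn
  rw [rainbowSepNumber_top]
  exact H.one_add_mul_ssp_le_card hk hkd hS

theorem exists_isRSPS_card_le {k n : ℕ} (hk : 2 ≤ k) (hn : 2 ^ (k + 1) ≤ n)
    {G : SimpleGraph (Fin n)} (hG : IsCompleteBinaryTree G) :
    ∃ S : Multiset (GraphPath G), IsRSPS k S ∧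
      (S.card : ℝ) ≤ ((n : ℝ) + 1) / k * (((k : ℝ) + 6) / 2) := by
  obtain ⟨d, hkd, hnd, ⟨H⟩⟩ := hG.exists_heapLabelling_of_two_pow_le hn
  obtain ⟨S, hS, hcard⟩ := H.exists_isRSPS_mul_card_le hk hkd
  refine ⟨S, hS, ?_⟩
  have hcard' : (k : ℝ) * S.card ≤ 2 ^ d * (k + 6) := by exact_mod_cast hcard
  have hnd' : (n : ℝ) + 1 = 2 ^ d * 2 := by
    rw [← pow_succ]
    exact_mod_cast hnd
  have hk0 : (0 : ℝ) < k := by positivity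
  rw [hnd', div_mul_eq_mul_div, le_div_iff₀ hk0]
  linarith

theorem classRatio_mem_Icc {k : ℕ} (hk : 2 ≤ k) :
    classRatio completeBinaryTrees k ∈
      Set.Icc (ENNReal.ofReal (1 + 1 / (16 : ℝ) ^ (k + 6))) (ENNReal.ofReal (1 + 6 / k)) := by
  have hratio : ∀ᶠ G : FinGraph in cofinite ⊓ 𝓟 completeBinaryTrees,
      ENNReal.ofReal (1 + 1 / (16 : ℝ) ^ (k + 6)) ≤ ratio G.2 k ∧
        ratio G.2 k ≤ ENNReal.ofReal (1 + 6 / k) :=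
    eventually_of_le_order (2 ^ (k + 6)) fun G hG hn => by
      obtain ⟨d, hkd, -, ⟨H⟩⟩ := hG.exists_heapLabelling_of_two_pow_le (D := k + 5) hn
      exact ⟨H.one_add_le_ratio hk hkd, H.ratio_le hk (by omega)⟩
  exact ⟨le_limsup_of_frequently_le (hratio.mono fun _ h => h.1).frequently,
    limsup_le_of_le (by isBoundedDefault) (hratio.mono fun _ h => h.2)⟩

theorem one_lt_classRatio {k : ℕ} (hk : 2 ≤ k) : 1 < classRatio completeBinaryTrees k := by
  refine lt_of_lt_of_le (ENNReal.one_lt_ofReal.2 ?_) (classRatio_mem_Icc hk).1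
  exact lt_add_of_pos_right 1 (by positivity)

theorem tendsto_classRatio :
    Tendsto (fun k : ℕ => classRatio completeBinaryTrees (k : ℕ∞)) atTop (𝓝 1) := by
  have hlim : Tendsto (fun k : ℕ => ENNReal.ofReal (1 + 6 / (k : ℝ))) atTop (𝓝 1) := by
    simpa using ENNReal.tendsto_ofReal
      ((tendsto_const_div_atTop_nhds_zero_nat (6 : ℝ)).const_add 1)
  refine tendsto_of_tendsto_of_tendsto_of_le_of_le' tendsto_const_nhds hlim ?_ ?_
  · filter_upwards [eventually_ge_atTop 2] with k hk using (one_lt_classRatio hk).le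
  · filter_upwards [eventually_ge_atTop 2] with k hk using (classRatio_mem_Icc hk).2

theorem IsRainbowSeparable.of_tendsto {A : Set FinGraph}
    (hA : Tendsto (fun k : ℕ => classRatio A (k : ℕ∞)) atTop (𝓝 1)) : IsRainbowSeparable A := by
  intro ε hε
  have hlt : (1 : ℝ≥0∞) < 1 + ENNReal.ofReal ε :=
    ENNReal.lt_add_right ENNReal.one_ne_top (ENNReal.ofReal_pos.2 hε).ne'
  obtain ⟨k, hk, hk2⟩ := ((hA.eventually_lt_const hlt).and (eventually_ge_atTop 2)).exists
  exact ⟨k, hk2, hk⟩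

theorem chromaticSepNumber_eq_top {A : Set FinGraph}
    (hA : ∀ k : ℕ, 2 ≤ k → classRatio A k ≠ 1) : chromaticSepNumber A = ⊤ := by
  rw [chromaticSepNumber, sInf_eq_top]
  rintro k ⟨hk, hk1⟩
  by_contra hne
  lift k to ℕ using hne
  exact hA k (by exact_mod_cast hk) hk1

end RainbowSep

end

theorem mainTheorem2 :
    IsRainbowSeparable completeBinaryTrees ∧
    chromaticSepNumber completeBinaryTrees = ⊤ ∧
    (∀ k : ℕ, 2 ≤ k → ∃ n₀ : ℕ, ∀ n : ℕ, n₀ ≤ n → ∀ G : SimpleGraph (Fin n),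
      IsCompleteBinaryTree G → ∀ S : Multiset (GraphPath G), IsRSPS k S →
        (1 + 1 / (16 : ℝ) ^ (k + 6)) * (rainbowSepNumber G ⊤ : ℝ) ≤ (S.card : ℝ)) ∧
    (∀ k : ℕ, 2 ≤ k → ∃ n₀ : ℕ, ∀ n : ℕ, n₀ ≤ n → ∀ G : SimpleGraph (Fin n),
      IsCompleteBinaryTree G → ∃ S : Multiset (GraphPath G), IsRSPS k S ∧
        (S.card : ℝ) ≤ ((n : ℝ) + 1) / k * (((k : ℝ) + 2 * Real.logb 2 k + 6) / 2)) ∧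
    Tendsto (fun k : ℕ => classRatio completeBinaryTrees (k : ℕ∞)) atTop (𝓝 1) := by
  refine ⟨.of_tendsto tendsto_classRatio,
    chromaticSepNumber_eq_top fun k hk => (one_lt_classRatio hk).ne',
    fun k hk => ⟨2 ^ (k + 6), fun n hn G hG S hS =>
      one_add_mul_rainbowSepNumber_top_le_card (by omega) hn hG hS⟩,
    fun k hk => ⟨2 ^ (k + 1), fun n hn G hG => ?_⟩, tendsto_classRatio⟩
  obtain ⟨S, hS, hcard⟩ := exists_isRSPS_card_le hk hn hG
  have hlog : 0 ≤ Real.logb 2 k :=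
    Real.logb_nonneg one_lt_two (by exact_mod_cast one_le_two.trans hk)
  refine ⟨S, hS, hcard.trans ?_⟩
  gcongr
  linarith
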